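/- Let $\tilde\gamma>0$ and, for every $N\ge 1$, let $\gamma_1,\dots,\gamma_N\in[0,\tilde\gamma]$ (with $\gamma_i=\gamma_i^{(N)}$) be such that the empirical measures $N^{-1}\sum_{i\le N}\delta_{\gamma_i}$ converge in the $1$-Wasserstein metric, as $N\to\infty$, to a probability measure $\rho$ on $\mathbb{R}$. For $g\in\mathbb{R}^N\setminus\{0\}$ put $H_N(g)=N\sum_{i\le N}\gamma_i g_i^2/\|g\|^2$ and $h_N=H_N/N$. For $\theta\in\mathbb{R}$ let $$\langle f(g)\rangle=\langle f(g)\rangle_\theta:=\frac1{Z_N(\theta)}\int_{\mathbb{R}^N}f(g)\,e^{\theta H_N(g)}\,dG(g),\qquad Z_N(\theta):=\int_{\mathbb{R}^N} e^{\theta H_N(g)}\,dG(g),$$ be the Gibbs mean, where $G$ is the standard normal measure on $\mathbb{R}^N$. Let $S_\rho(z)=\int_{[0,\tilde\gamma]}\rho(d\gamma)/(z-\gamma)$ for $z\in\mathbb{R}\setminus[0,\tilde\gamma]$, let $S_{max}=\lim_{z\downarrow\tilde\gamma}S_\rho(z)$ and $S_{min}=\lim_{z\uparrow0}S_\rho(z)$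 (possibly infinite), let $K_\rho:(S_{min},S_{max})\setminus\{0\}\to\mathbb{R}\setminus[0,\tilde\gamma]$ be the inverse of $S_\rho$, and let $R_\rho(x)=K_\rho(x)-1/x$. Put $T_\rho=(S_{min}/2,S_{max}/2)\setminus\{0\}$ and, for $\theta\in T_\rho$, $$v(\theta)=R_\rho(2\theta),\qquad a_N(\theta)=\big\langle(h_N-v(\theta))^2\big\rangle_\theta,\qquad \tilde a_N(\theta)=\frac1{\sqrt N}+\sqrt{a_N(\theta)}.$$ Let $\theta\in T_\rho$ and $k\ge1$. Then $1+2\theta(v(\theta)-\gamma)>0$ for all $\gamma\in[0,\tilde\gamma]$. Let $\mu_\gamma$ be the centred normal law on $\mathbb{R}$ of variance $1/(1+2\theta(v(\theta)-\gamma))$. (i) There is a constant $K'(\theta,k)>0$, independent of $N$, of the indices and of $f$, such that for every $N$, all distinct indices $d_1,\dots,d_k\in\{1,\dots,N\}$ and every bounded measurable $f:\mathbb{R}^k\to\mathbb{R}$, $$\Big|\langle f(g_{d_1},\dots,g_{d_k})\rangle-\int_{\mathbb{R}^k}f(x_1,\dots,x_k)\,d\mu_{\gamma_{d_1}}(x_1)\cdots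 d\mu_{\gamma_{d_k}}(x_k)\Big|\le K'(\theta,k)\,\|f\|_\infty\,\tilde a_N(\theta).$$ (ii) $\tilde a_N(\theta)\to0$ as $N\to\infty$. (iii) Consequently the finite marginals converge weakly to independent Gaussians: along any sequence of sizes $N\to\infty$ and any choice of $k$ distinct indices $d_1,\dots,d_k\le N$ (which may depend on $N$), the difference on the left-hand side of (i) tends to $0$ for every bounded continuous $f$; and if moreover $\gamma_{d_i}^{(N)}\to c_i$ for $i=1,\dots,k$, then the law of $(g_{d_1},\dots,g_{d_k})$ under $\langle\cdot\rangle$ converges weakly to $\mu_{c_1}\otimes\cdots\otimes\mu_{c_k}$. -/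

import Mathlib

open MeasureTheory ProbabilityTheory Filter Topology Set
open scoped ENNReal NNReal BoundedContinuousFunction

noncomputable section

namespace SphericalModel

/-- The `1`-Wasserstein distance on `ℝ`: the infimum of the transport cost `∫ |x - y| dπ(x, y)`
over all couplings `π` of `μ` and `ν` (it is `∞` if there is no coupling). -/
def wasserstein1 (μ ν : Measure ℝ) : ℝ≥0∞ :=
  ⨅ π ∈ {π : Measure (ℝ × ℝ) | π.map Prod.fst = μ ∧ π.map Prod.snd = ν},
    ∫⁻ p, edist p.1 p.2 ∂π

/-- The empirical measure `N⁻¹ ∑ i, δ_{c i}` of a family of `N` real numbers. -/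
def empiricalMeasure {N : ℕ} (c : Fin N → ℝ) : Measure ℝ :=
  (N : ℝ≥0∞)⁻¹ • ∑ i, Measure.dirac (c i)

/-- The standard normal measure on `ℝ^N`. -/
def stdNormal (N : ℕ) : Measure (Fin N → ℝ) :=
  Measure.pi fun _ => gaussianReal 0 1

/-- The Hamiltonian `H_N(g) = N ∑ i, c i * g i ^ 2 / ‖g‖ ^ 2`, with the Euclidean norm. -/
def hamiltonian {N : ℕ} (c : Fin N → ℝ) (g : Fin N → ℝ) : ℝ :=
  N * ∑ i, c i * (g i ^ 2 / ∑ j, g j ^ 2)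

/-- The intensive energy `h_N = H_N / N`. -/
def energy {N : ℕ} (c : Fin N → ℝ) (g : Fin N → ℝ) : ℝ :=
  hamiltonian c g / N

/-- The partition function `Z_N(θ)`. -/
def partitionFunction {N : ℕ} (c : Fin N → ℝ) (θ : ℝ) : ℝ :=
  ∫ g, Real.exp (θ * hamiltonian c g) ∂(stdNormal N)

/-- The Gibbs mean `⟨f⟩_θ`. -/
def gibbsMean {N : ℕ} (c : Fin N → ℝ) (θ : ℝ) (f : (Fin N → ℝ) → ℝ) : ℝ :=
  1 / partitionFunction c θ * ∫ g, f g * Real.exp (θ * hamiltonian c g) ∂(stdNormal N)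

/-- The Stieltjes transform `S_ρ(z) = ∫_{[0, b]} ρ(dx) / (z - x)`, used for `z ∉ [0, b]`. -/
def stieltjes (ρ : Measure ℝ) (b z : ℝ) : ℝ :=
  ∫ x in Icc 0 b, 1 / (z - x) ∂ρ

/-- `S_max`, the possibly infinite limit of `S_ρ(z)` as `z` decreases to `b`. -/
def stieltjesMax (ρ : Measure ℝ) (b : ℝ) : EReal :=
  limUnder (𝓝[>] b) fun z => (stieltjes ρ b z : EReal)

/-- `S_min`, the possibly infinite limit of `S_ρ(z)` as `z` increases to `0`. -/
def stieltjesMin (ρ : Measure ℝ) (b : ℝ) : EReal :=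
  limUnder (𝓝[<] (0 : ℝ)) fun z => (stieltjes ρ b z : EReal)

/-- The high-temperature region `T_ρ = (S_min / 2, S_max / 2) \ {0}`. -/
def highTemp (ρ : Measure ℝ) (b : ℝ) : Set ℝ :=
  {θ | stieltjesMin ρ b < ((2 * θ : ℝ) : EReal) ∧ ((2 * θ : ℝ) : EReal) < stieltjesMax ρ b ∧
    θ ≠ 0}

/-- The inverse `K_ρ` of `S_ρ : ℝ \ [0, b] → (S_min, S_max) \ {0}`. -/
def stieltjesInv (ρ : Measure ℝ) (b : ℝ) : ℝ → ℝ :=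
  Function.invFunOn (stieltjes ρ b) (Icc 0 b)ᶜ

/-- The R-transform `R_ρ(x) = K_ρ(x) - 1 / x`. -/
def rTransform (ρ : Measure ℝ) (b x : ℝ) : ℝ :=
  stieltjesInv ρ b x - 1 / x

/-- The limiting energy `v(θ) = R_ρ(2θ)`. -/
def limitEnergy (ρ : Measure ℝ) (b θ : ℝ) : ℝ :=
  rTransform ρ b (2 * θ)

/-- `a_N(θ) = ⟨(h_N - v(θ))²⟩_θ`. -/
def energyError (ρ : Measure ℝ) (b θ : ℝ) {N : ℕ} (c : Fin N → ℝ) : ℝ :=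
  gibbsMean c θ fun g => (energy c g - limitEnergy ρ b θ) ^ 2

/-- The rate `1 / √N + √(a_N(θ))`. -/
def rate (ρ : Measure ℝ) (b θ : ℝ) {N : ℕ} (c : Fin N → ℝ) : ℝ :=
  1 / √(N : ℝ) + √(energyError ρ b θ c)

/-- The centred Gaussian law `μ_x` with variance `1 / (1 + 2θ(v(θ) - x))`. -/
def marginalLaw (ρ : Measure ℝ) (b θ x : ℝ) : Measure ℝ :=
  gaussianReal 0 (Real.toNNReal (1 / (1 + 2 * θ * (limitEnergy ρ b θ - x))))

end SphericalModel

end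

namespace SphericalModel

/-! ### Wasserstein convergence and integrals of Lipschitz functions -/

/-! The proof is an exchange argument. Put an independent vector `x` on `ℝ^k`, with the proposed
product Gaussian law, beside the Gibbs vector `g`. Both laws are tilts of standard normal measures,
the second by `θ ∑ (γ_{d i} - v) x_i ^ 2` (`gaussianPi_eq_tilted`), so the joint law is a tilt by
some `u` of a standard normal measure on `ℝ^N × ℝ^k`. Swapping the coordinates `g (d i)` with `x` is
an involution `T` that preserves the untilted measure. The marginals before and after the swap
therefore differ by at most `2 ‖f‖` times the mean of `min 1 |u - u ∘ T|`
(`abs_integral_tilted_sub_comp_le`).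

The change of exponent is explicit. Let `R = ‖g‖²`, and let `ξ`, `ξ'` and `a`, `a'` be the squared
lengths and energies of the outgoing and incoming blocks. The energy term changes by about `θ (N /
R) (h (ξ' - ξ) - (a' - a))`, and the Gaussian tilt cancels this when `R` is near `N` and `h_N` near
`v`. The error is controlled by `(R - N) / N`, `h_N - v` and fourth moments of coordinates
(`min_one_abs_exchange_le`), and `abs_integral_gibbs_sub_le` collects this into the total variation
bound.

The moments come from a comparison with a Gaussian vector. Choose `κ` with `N⁻¹ ∑ 1 / (κ - γ_i) =
2θ` and set `l_i = 2θ (κ - γ_i)`. Up to a constant the Gibbs exponent is `N (1 - σ) / 2`, where `σ`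
is the Rayleigh quotient of `l`. The Gaussian with precisions `l` has angular density proportional
to `σ ^ (-N/2)` (`exists_integral_gaussianPi_eq`). Pointwise `exp (N (1 - σ) / 2) ≤ σ ^ (-N/2)`. The
condition on `κ` centres `σ` at `1` with fluctuations of order `N ^ (-1/2)`, so the total masses are
comparable uniformly in `N`. Hence Gibbs means of functions of the direction are bounded by Gaussian
ones (`integral_rayleighGibbs_le`), while the length keeps its standard normal law and is
independent of the direction.

Since `h_N = κ - σ / (2θ)` and `v = K_ρ(2θ) - 1 / (2θ)`, the rate vanishes once `κ` tends to
`K_ρ(2θ)`. This follows from convergence and strict monotonicity of the empirical Stieltjes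
transforms (`eventually_exists_sum_one_div_eq`). -/

theorem ofReal_abs_integral_sub_le_mul_wasserstein1 {μ ν : Measure ℝ} [IsProbabilityMeasure μ]
    {L : ℝ≥0} (hL : L ≠ 0) {φ : ℝ → ℝ} (hφ : LipschitzWith L φ) {B : ℝ} (hB : ∀ x, |φ x| ≤ B) :
    ENNReal.ofReal |∫ x, φ x ∂μ - ∫ x, φ x ∂ν| ≤ L * wasserstein1 μ ν := by
  have hL' : (L : ℝ≥0∞) ≠ 0 := by simpa using hL
  rw [← ENNReal.div_le_iff' hL' ENNReal.coe_ne_top]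
  refine le_iInf₂ fun π hπ => ?_
  obtain ⟨h1, h2⟩ := hπ
  rw [ENNReal.div_le_iff' hL' ENNReal.coe_ne_top]
  have hπp : IsProbabilityMeasure π := by
    refine ⟨?_⟩
    have : π.map Prod.fst univ = 1 := by rw [h1]; exact measure_univ
    rwa [Measure.map_apply measurable_fst MeasurableSet.univ, preimage_univ] at this
  have hm : Measurable φ := hφ.continuous.measurable
  have hi1 : Integrable (fun p : ℝ × ℝ => φ p.1) π :=
    Integrable.of_bound (hm.comp measurable_fst).aestronglyMeasurable B
      (ae_of_all _ fun p => hB p.1)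
  have hi2 : Integrable (fun p : ℝ × ℝ => φ p.2) π :=
    Integrable.of_bound (hm.comp measurable_snd).aestronglyMeasurable B
      (ae_of_all _ fun p => hB p.2)
  have e1 : ∫ x, φ x ∂μ = ∫ p, φ p.1 ∂π := by
    rw [← h1, integral_map measurable_fst.aemeasurable hm.aestronglyMeasurable]
  have e2 : ∫ x, φ x ∂ν = ∫ p, φ p.2 ∂π := by
    rw [← h2, integral_map measurable_snd.aemeasurable hm.aestronglyMeasurable]
  rw [e1, e2, ← integral_sub hi1 hi2, ← lintegral_const_mul _ (by fun_prop)]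
  calc ENNReal.ofReal |∫ p, (φ p.1 - φ p.2) ∂π|
      = ‖∫ p, (φ p.1 - φ p.2) ∂π‖ₑ := by rw [Real.enorm_eq_ofReal_abs]
    _ ≤ ∫⁻ p, ‖φ p.1 - φ p.2‖ₑ ∂π := enorm_integral_le_lintegral_enorm _
    _ ≤ ∫⁻ p, L * edist p.1 p.2 ∂π := by
        refine lintegral_mono fun p => ?_
        rw [← edist_eq_enorm_sub]
        exact hφ p.1 p.2

theorem isProbabilityMeasure_empiricalMeasure {N : ℕ} (hN : N ≠ 0) (c : Fin N → ℝ) :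
    IsProbabilityMeasure (empiricalMeasure c) := by
  refine ⟨?_⟩
  simp only [empiricalMeasure, Measure.smul_apply, Measure.finsetSum_apply, measure_univ,
    Finset.sum_const, Finset.card_univ, Fintype.card_fin, smul_eq_mul, nsmul_eq_mul, mul_one]
  exact ENNReal.inv_mul_cancel (by simpa using hN) (ENNReal.natCast_ne_top _)

theorem integral_empiricalMeasure {N : ℕ} (c : Fin N → ℝ) {φ : ℝ → ℝ} :
    ∫ x, φ x ∂(empiricalMeasure c) = (N : ℝ)⁻¹ * ∑ i, φ (c i) := by
  rw [empiricalMeasure, integral_smul_measure, integral_finsetSum_measure]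
  · simp
  · intro i _
    exact integrable_dirac (by simp)

theorem tendsto_sum_of_wasserstein1 {γ : (N : ℕ) → Fin N → ℝ} {ρ : Measure ℝ}
    (hρ : Tendsto (fun N => wasserstein1 (empiricalMeasure (γ N)) ρ) atTop (𝓝 0))
    {L : ℝ≥0} {φ : ℝ → ℝ} (hφ : LipschitzWith L φ) {B : ℝ} (hB : ∀ x, |φ x| ≤ B) :
    Tendsto (fun N : ℕ => (N : ℝ)⁻¹ * ∑ i, φ (γ N i)) atTop (𝓝 (∫ x, φ x ∂ρ)) := by
  rw [tendsto_iff_dist_tendsto_zero]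
  -- The constant must be nonzero: the Wasserstein distance may be `∞`, and `0 * ∞ = 0` would make
  -- the estimate false.
  have hL : LipschitzWith (L + 1) φ := hφ.weaken (by simp)
  have h0 : Tendsto (fun N => ((L + 1 : ℝ≥0) : ℝ≥0∞) *
      wasserstein1 (empiricalMeasure (γ N)) ρ) atTop (𝓝 0) := by
    simpa using ENNReal.Tendsto.const_mul (a := ((L + 1 : ℝ≥0) : ℝ≥0∞)) hρ
      (Or.inr ENNReal.coe_ne_top)
  have h1 : Tendsto (fun N : ℕ => ENNReal.ofReal
      (dist ((N : ℝ)⁻¹ * ∑ i, φ (γ N i)) (∫ x, φ x ∂ρ))) atTop (𝓝 0) := by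
    refine tendsto_of_tendsto_of_tendsto_of_le_of_le' tendsto_const_nhds h0
      (Eventually.of_forall fun _ => zero_le) ?_
    filter_upwards [eventually_ne_atTop 0] with N hN
    have := isProbabilityMeasure_empiricalMeasure hN (γ N)
    rw [← integral_empiricalMeasure, Real.dist_eq]
    exact ofReal_abs_integral_sub_le_mul_wasserstein1 (by positivity) hL hB
  have h2 := (ENNReal.tendsto_toReal ENNReal.zero_ne_top).comp h1
  simpa [Function.comp_def, ENNReal.toReal_ofReal dist_nonneg] using h2

/-- The nearest-point projection of `ℝ` onto `[0, b]`. -/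
noncomputable def clamp (b x : ℝ) : ℝ := max 0 (min b x)

theorem clamp_mem {b : ℝ} (hb : 0 < b) (x : ℝ) : clamp b x ∈ Icc 0 b :=
  ⟨le_max_left _ _, max_le hb.le (min_le_left _ _)⟩

theorem clamp_of_mem {b x : ℝ} (hx : x ∈ Icc 0 b) : clamp b x = x := by
  rw [clamp, min_eq_right hx.2, max_eq_right hx.1]

theorem lipschitzWith_clamp (b : ℝ) : LipschitzWith 1 (clamp b) :=
  (LipschitzWith.id.const_min b).const_max 0

/-- The truncated distance to `[0, b]` is a bounded Lipschitz test function that vanishes on every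
empirical measure, so its `ρ`-integral is zero. After this the restriction to `[0, b]` in
`stieltjes` costs no mass. -/
theorem ae_mem_Icc_of_wasserstein1 {b : ℝ} (hb : 0 < b) {γ : (N : ℕ) → Fin N → ℝ}
    (hγ : ∀ N i, γ N i ∈ Icc 0 b) {ρ : Measure ℝ} [IsProbabilityMeasure ρ]
    (hρ : Tendsto (fun N => wasserstein1 (empiricalMeasure (γ N)) ρ) atTop (𝓝 0)) :
    ∀ᵐ x ∂ρ, x ∈ Icc 0 b := by
  set φ : ℝ → ℝ := fun x => min 1 |x - clamp b x| with hφdef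
  have hφ : LipschitzWith (1 * (1 + 1)) φ := by
    exact (lipschitzWith_one_norm.comp
      (LipschitzWith.id.sub (lipschitzWith_clamp b))).const_min 1
  have hφ0 : ∀ x, 0 ≤ φ x := fun x => le_min zero_le_one (abs_nonneg _)
  have hB : ∀ x, |φ x| ≤ 1 := fun x => by
    rw [abs_of_nonneg (hφ0 x)]; exact min_le_left _ _
  have ht := tendsto_sum_of_wasserstein1 hρ hφ hB
  have hz : ∀ N : ℕ, (N : ℝ)⁻¹ * ∑ i, φ (γ N i) = 0 := fun N => by
    rw [Finset.sum_eq_zero, mul_zero]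
    intro i _
    simp [hφdef, clamp_of_mem (hγ N i)]
  simp only [hz] at ht
  have h0 : ∫ x, φ x ∂ρ = 0 := tendsto_nhds_unique ht tendsto_const_nhds
  have hi : Integrable φ ρ :=
    Integrable.of_bound hφ.continuous.measurable.aestronglyMeasurable 1 (ae_of_all _ hB)
  rw [integral_eq_zero_iff_of_nonneg hφ0 hi] at h0
  filter_upwards [h0] with x hx
  have hx' : |x - clamp b x| = 0 := by
    rcases min_choice (1 : ℝ) |x - clamp b x| with h | h
    · simp only [hφdef, Pi.zero_apply, h] at hx; norm_num at hx
    · simp only [hφdef, Pi.zero_apply, h] at hx; exact hx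
  rw [abs_eq_zero, sub_eq_zero] at hx'
  rw [hx']
  exact clamp_mem hb x

/-! ### The Stieltjes transform off the support -/

theorem exists_gap {b z : ℝ} (hz : z ∉ Icc 0 b) : ∃ δ > 0, ∀ x ∈ Icc 0 b, δ ≤ |z - x| := by
  rcases lt_or_ge z 0 with h | h
  · refine ⟨-z, by linarith, fun x hx => ?_⟩
    rw [abs_of_nonpos (by linarith [hx.1])]; linarith [hx.1]
  · have : b < z := by
      by_contra hc
      exact hz ⟨h, not_lt.1 hc⟩
    refine ⟨z - b, by linarith, fun x hx => ?_⟩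
    rw [abs_of_nonneg (by linarith [hx.2])]; linarith [hx.2]

theorem sub_ne_zero_of_notMem {b z x : ℝ} (hz : z ∉ Icc 0 b) (hx : x ∈ Icc 0 b) : z - x ≠ 0 :=
  sub_ne_zero.2 fun h => hz (h ▸ hx)

theorem integrableOn_one_div_sub {b z : ℝ} (hz : z ∉ Icc 0 b) (ρ : Measure ℝ)
    [IsFiniteMeasure ρ] : IntegrableOn (fun x => 1 / (z - x)) (Icc 0 b) ρ := by
  obtain ⟨δ, hδ, hgap⟩ := exists_gap hz
  refine Integrable.of_bound (by measurability) (1 / δ) ?_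
  filter_upwards [ae_restrict_mem measurableSet_Icc] with x hx
  rw [Real.norm_eq_abs, abs_div, abs_one]
  exact one_div_le_one_div_of_le hδ (hgap x hx)

/-- The kernel `x ↦ 1 / (z - x)` is singular at `z`. Precomposing with `clamp b` makes it bounded by
`1 / δ` and Lipschitz with constant `1 / δ²` on all of `ℝ`, and changes nothing on `[0, b]`. -/
theorem tendsto_sum_one_div_sub {b : ℝ} (hb : 0 < b) {γ : (N : ℕ) → Fin N → ℝ}
    (hγ : ∀ N i, γ N i ∈ Icc 0 b) {ρ : Measure ℝ} [IsProbabilityMeasure ρ]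
    (hρ : Tendsto (fun N => wasserstein1 (empiricalMeasure (γ N)) ρ) atTop (𝓝 0))
    {z : ℝ} (hz : z ∉ Icc 0 b) :
    Tendsto (fun N : ℕ => (N : ℝ)⁻¹ * ∑ i, 1 / (z - γ N i)) atTop (𝓝 (stieltjes ρ b z)) := by
  obtain ⟨δ, hδ, hgap⟩ := exists_gap hz
  set φ : ℝ → ℝ := fun x => 1 / (z - clamp b x) with hφdef
  have hB : ∀ x, |φ x| ≤ 1 / δ := fun x => by
    rw [hφdef, abs_div, abs_one]
    exact one_div_le_one_div_of_le hδ (hgap _ (clamp_mem hb x))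
  have hφ : LipschitzWith (Real.toNNReal (1 / δ * (1 / δ))) φ := by
    refine LipschitzWith.of_dist_le_mul fun x y => ?_
    rw [Real.coe_toNNReal _ (by positivity), Real.dist_eq]
    have hx := sub_ne_zero_of_notMem hz (clamp_mem hb x)
    have hy := sub_ne_zero_of_notMem hz (clamp_mem hb y)
    have e : φ x - φ y = φ x * φ y * (clamp b x - clamp b y) := by
      simp only [hφdef]; field_simp; ring
    rw [e, abs_mul, abs_mul]
    have h1 := (lipschitzWith_clamp b).dist_le_mul x y
    rw [NNReal.coe_one, one_mul, Real.dist_eq] at h1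
    gcongr
    · exact hB x
    · exact hB y
  have ht := tendsto_sum_of_wasserstein1 hρ hφ hB
  have hae := ae_mem_Icc_of_wasserstein1 hb hγ hρ
  have e : ∫ x, φ x ∂ρ = stieltjes ρ b z := by
    rw [stieltjes, Measure.restrict_eq_self_of_ae_mem hae]
    refine integral_congr_ae ?_
    filter_upwards [hae] with x hx
    simp only [hφdef, clamp_of_mem hx]
  rw [e] at ht
  refine ht.congr fun N => ?_
  simp only [hφdef, clamp_of_mem (hγ N _)]

section Support

variable {b : ℝ} {ρ : Measure ℝ} [IsProbabilityMeasure ρ]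

theorem continuousOn_stieltjes : ContinuousOn (stieltjes ρ b) (Icc 0 b)ᶜ := by
  intro z hz
  refine ContinuousAt.continuousWithinAt ?_
  obtain ⟨δ, hδ, hgap⟩ := exists_gap hz
  refine continuousAt_of_dominated (bound := fun _ => 1 / (δ / 2)) ?_ ?_ (integrable_const _) ?_
  · exact Eventually.of_forall fun w => by measurability
  · filter_upwards [Metric.ball_mem_nhds z (half_pos hδ)] with w hw
    filter_upwards [ae_restrict_mem measurableSet_Icc] with x hx
    rw [Real.norm_eq_abs, abs_div, abs_one]
    refine one_div_le_one_div_of_le (half_pos hδ) ?_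
    have h1 := hgap x hx
    rw [Metric.mem_ball, Real.dist_eq, abs_sub_comm] at hw
    have h2 := abs_sub_abs_le_abs_sub (z - x) (z - w)
    rw [sub_sub_sub_cancel_left] at h2
    linarith
  · filter_upwards [ae_restrict_mem measurableSet_Icc] with x hx
    have := sub_ne_zero_of_notMem hz hx
    exact ContinuousAt.div continuousAt_const (by fun_prop) this

theorem le_stieltjes_of_le (hae : ∀ᵐ x ∂ρ, x ∈ Icc 0 b) {z c : ℝ} (hz : z ∉ Icc 0 b)
    (h : ∀ x ∈ Icc 0 b, c ≤ 1 / (z - x)) : c ≤ stieltjes ρ b z := by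
  have hi := integrableOn_one_div_sub hz ρ
  rw [stieltjes]
  rw [IntegrableOn, Measure.restrict_eq_self_of_ae_mem hae] at hi
  rw [Measure.restrict_eq_self_of_ae_mem hae]
  calc c = ∫ _, c ∂ρ := by simp
    _ ≤ _ := integral_mono_ae (integrable_const _) hi
        (by filter_upwards [hae] with x hx using h x hx)

theorem stieltjes_le_of_le (hae : ∀ᵐ x ∂ρ, x ∈ Icc 0 b) {z c : ℝ} (hz : z ∉ Icc 0 b)
    (h : ∀ x ∈ Icc 0 b, 1 / (z - x) ≤ c) : stieltjes ρ b z ≤ c := by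
  have hi := integrableOn_one_div_sub hz ρ
  rw [stieltjes]
  rw [IntegrableOn, Measure.restrict_eq_self_of_ae_mem hae] at hi
  rw [Measure.restrict_eq_self_of_ae_mem hae]
  calc _ ≤ ∫ _, c ∂ρ :=
        integral_mono_ae hi (integrable_const _) (by filter_upwards [hae] with x hx using h x hx)
    _ = c := by simp

/-- On an interval that avoids `[0, b]` the Stieltjes transform is strictly decreasing. -/
theorem stieltjes_lt_stieltjes (hae : ∀ᵐ x ∂ρ, x ∈ Icc 0 b) {z w : ℝ} (hzw : z < w)
    (h : w < 0 ∨ b < z) (hb : 0 < b) : stieltjes ρ b w < stieltjes ρ b z := by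
  have hz : z ∉ Icc 0 b := fun hm => by rcases h with h | h <;> linarith [hm.1, hm.2]
  have hw : w ∉ Icc 0 b := fun hm => by rcases h with h | h <;> linarith [hm.1, hm.2]
  have hiz := integrableOn_one_div_sub hz ρ
  have hiw := integrableOn_one_div_sub hw ρ
  -- A lower bound, uniform in `x ∈ [0, b]`, for `1 / (z - x) - 1 / (w - x)`; it turns the pointwise
  -- inequality into a strict one between integrals.
  set c : ℝ := (w - z) / ((|z| + b) * (|w| + b)) with hc
  have hcpos : 0 < c := by have := sub_pos.2 hzw; positivity
  have key : ∀ x ∈ Icc 0 b, c + 1 / (w - x) ≤ 1 / (z - x) := by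
    intro x hx
    have h1 := sub_ne_zero_of_notMem hz hx
    have h2 := sub_ne_zero_of_notMem hw hx
    have e : 1 / (z - x) - 1 / (w - x) = (w - z) / ((z - x) * (w - x)) := by field_simp; ring
    have hp : 0 < (z - x) * (w - x) := by
      rcases h with h | h
      · exact mul_pos_of_neg_of_neg (by linarith [hx.1]) (by linarith [hx.1])
      · exact mul_pos (by linarith [hx.2]) (by linarith [hx.2])
    have hle : (z - x) * (w - x) ≤ (|z| + b) * (|w| + b) := by
      rw [← abs_of_pos hp, abs_mul]
      have a1 : |z - x| ≤ |z| + b :=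
        (abs_sub _ _).trans (by rw [abs_of_nonneg hx.1]; linarith [hx.2])
      have a2 : |w - x| ≤ |w| + b :=
        (abs_sub _ _).trans (by rw [abs_of_nonneg hx.1]; linarith [hx.2])
      gcongr
    have : c ≤ (w - z) / ((z - x) * (w - x)) :=
      div_le_div_of_nonneg_left (by linarith) hp hle
    linarith
  have : c + stieltjes ρ b w ≤ stieltjes ρ b z := by
    rw [stieltjes, stieltjes]
    rw [IntegrableOn, Measure.restrict_eq_self_of_ae_mem hae] at hiz hiw
    rw [Measure.restrict_eq_self_of_ae_mem hae]
    calc c + ∫ x, 1 / (w - x) ∂ρ = ∫ x, (c + 1 / (w - x)) ∂ρ := by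
          rw [integral_add (integrable_const _) hiw]; simp
      _ ≤ _ := integral_mono_ae ((integrable_const _).add hiw) hiz
          (by filter_upwards [hae] with x hx using key x hx)
  linarith

/-- By monotonicity the one-sided limits defining `stieltjesMin` and `stieltjesMax` are an infimum
and a supremum in `EReal`, so some point gives a value beyond `2θ`. At distance `1 / |θ|` outside
`[0, b]` the transform is at most `|θ| < 2|θ|` in absolute value, and the intermediate value theorem
applies between the two points. -/
theorem exists_stieltjes_eq (hb : 0 < b) (hae : ∀ᵐ x ∂ρ, x ∈ Icc 0 b) {θ : ℝ}
    (hθ : θ ∈ highTemp ρ b) : ∃ z ∈ (Icc 0 b)ᶜ, stieltjes ρ b z = 2 * θ := by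
  obtain ⟨hmin, hmax, h0⟩ := hθ
  have hIoi : Ioi b ⊆ (Icc 0 b)ᶜ := fun z hz hm => not_lt.2 hm.2 hz
  have hIio : Iio 0 ⊆ (Icc 0 b)ᶜ := fun z hz hm => not_lt.2 hm.1 hz
  rcases lt_or_gt_of_ne h0 with hneg | hpos
  · have hanti : AntitoneOn (fun z => (stieltjes ρ b z : EReal)) (Iio 0) := by
      intro z hz w hw hzw
      rcases hzw.eq_or_lt with rfl | hlt
      · exact le_rfl
      · exact EReal.coe_le_coe_iff.2 (stieltjes_lt_stieltjes hae hlt (Or.inl hw) hb).le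
    rw [stieltjesMin, (hanti.tendsto_nhdsLT (OrderBot.bddBelow _)).limUnder_eq, sInf_lt_iff] at hmin
    obtain ⟨_, ⟨z₁, hz₁, rfl⟩, hlt⟩ := hmin
    have hlt : stieltjes ρ b z₁ < 2 * θ := EReal.coe_lt_coe_iff.1 hlt
    have hz₂ : 1 / θ ∈ Iio 0 := one_div_neg.2 hneg
    have hge : 1 / (1 / θ) ≤ stieltjes ρ b (1 / θ) := by
      refine le_stieltjes_of_le hae (hIio hz₂) fun x hx => ?_
      have h1 : 1 / θ < 0 := hz₂
      exact one_div_le_one_div_of_neg_of_le h1 (by linarith [hx.1])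
    rw [one_div_one_div] at hge
    obtain ⟨z, hz, he⟩ := isPreconnected_Iio.intermediate_value hz₁ hz₂
      (continuousOn_stieltjes.mono hIio) ⟨hlt.le, by linarith⟩
    exact ⟨z, hIio hz, he⟩
  · have hanti : AntitoneOn (fun z => (stieltjes ρ b z : EReal)) (Ioi b) := by
      intro z hz w hw hzw
      rcases hzw.eq_or_lt with rfl | hlt
      · exact le_rfl
      · exact EReal.coe_le_coe_iff.2 (stieltjes_lt_stieltjes hae hlt (Or.inr hz) hb).le
    rw [stieltjesMax, (hanti.tendsto_nhdsGT (OrderTop.bddAbove _)).limUnder_eq, lt_sSup_iff] at hmax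
    obtain ⟨_, ⟨z₁, hz₁, rfl⟩, hlt⟩ := hmax
    have hlt : 2 * θ < stieltjes ρ b z₁ := EReal.coe_lt_coe_iff.1 hlt
    have hp : 0 < 1 / θ := one_div_pos.2 hpos
    have hz₂ : b + 1 / θ ∈ Ioi b := lt_add_of_pos_right _ hp
    have hge : stieltjes ρ b (b + 1 / θ) ≤ 1 / (1 / θ) := by
      refine stieltjes_le_of_le hae (hIoi hz₂) fun x hx => ?_
      exact one_div_le_one_div_of_le hp (by linarith [hx.2])
    rw [one_div_one_div] at hge
    obtain ⟨z, hz, he⟩ := isPreconnected_Ioi.intermediate_value hz₂ hz₁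
      (continuousOn_stieltjes.mono hIoi) ⟨by linarith, hlt.le⟩
    exact ⟨z, hIoi hz, he⟩

theorem lt_zero_or_lt_of_stieltjes_eq (hae : ∀ᵐ x ∂ρ, x ∈ Icc 0 b) {z θ : ℝ}
    (hz : z ∉ Icc 0 b) (he : stieltjes ρ b z = 2 * θ) (hb : 0 < b) :
    (z < 0 ∧ θ < 0) ∨ (b < z ∧ 0 < θ) := by
  rcases lt_or_ge z 0 with h | h
  · left
    refine ⟨h, ?_⟩
    have : stieltjes ρ b z ≤ 1 / (z - b) := stieltjes_le_of_le hae hz fun x hx =>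
      one_div_le_one_div_of_neg_of_le (by linarith [hx.1]) (by linarith [hx.2])
    have h2 : 1 / (z - b) < 0 := one_div_neg.2 (by linarith)
    linarith
  · right
    have hbz : b < z := by
      by_contra hc
      exact hz ⟨h, not_lt.1 hc⟩
    refine ⟨hbz, ?_⟩
    have : 1 / z ≤ stieltjes ρ b z := le_stieltjes_of_le hae hz fun x hx =>
      one_div_le_one_div_of_le (by linarith [hx.2]) (by linarith [hx.1])
    have h2 : 0 < 1 / z := one_div_pos.2 (by linarith)
    linarith

end Support

/-- The empirical saddle points `κ`, solving `N⁻¹ ∑ 1 / (κ - γ i) = 2θ`, approach that of `ρ`. -/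
theorem eventually_exists_sum_one_div_eq {b : ℝ} (hb : 0 < b) {γ : (N : ℕ) → Fin N → ℝ}
    (hγ : ∀ N i, γ N i ∈ Icc 0 b) {ρ : Measure ℝ} [IsProbabilityMeasure ρ]
    (hρ : Tendsto (fun N => wasserstein1 (empiricalMeasure (γ N)) ρ) atTop (𝓝 0))
    {z x₀ ε : ℝ} (hε : 0 < ε) (hz : z + ε < 0 ∨ b < z - ε) (he : stieltjes ρ b z = x₀) :
    ∀ᶠ N : ℕ in atTop, ∃ κ, |κ - z| ≤ ε ∧ (N : ℝ)⁻¹ * ∑ i, 1 / (κ - γ N i) = x₀ := by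
  have hae := ae_mem_Icc_of_wasserstein1 hb hγ hρ
  have hout : ∀ w ∈ Icc (z - ε) (z + ε), w ∉ Icc 0 b := fun w hw hm => by
    rcases hz with h | h <;> linarith [hm.1, hm.2, hw.1, hw.2]
  have hl := tendsto_sum_one_div_sub hb hγ hρ (hout (z - ε) ⟨le_rfl, by linarith⟩)
  have hr := tendsto_sum_one_div_sub hb hγ hρ (hout (z + ε) ⟨by linarith, le_rfl⟩)
  have h1 : x₀ < stieltjes ρ b (z - ε) := by
    rw [← he]
    exact stieltjes_lt_stieltjes hae (by linarith)
      (hz.imp (fun h => by linarith) (fun h => h)) hb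
  have h2 : stieltjes ρ b (z + ε) < x₀ := by
    rw [← he]
    exact stieltjes_lt_stieltjes hae (by linarith)
      (hz.imp (fun h => h) (fun h => by linarith)) hb
  filter_upwards [hl.eventually_const_lt h1, hr.eventually_lt_const h2] with N hN1 hN2
  have hcont : ContinuousOn (fun κ => (N : ℝ)⁻¹ * ∑ i, 1 / (κ - γ N i)) (Icc (z - ε) (z + ε)) := by
    refine continuousOn_const.mul (continuousOn_finsetSum _ fun i _ => ?_)
    refine continuousOn_const.div (by fun_prop) fun w hw => ?_
    exact sub_ne_zero_of_notMem (hout w hw) (hγ N i)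
  obtain ⟨κ, hκ, hκe⟩ := intermediate_value_Icc' (by linarith) hcont ⟨hN2.le, hN1.le⟩
  exact ⟨κ, abs_le.2 ⟨by linarith [hκ.1], by linarith [hκ.2]⟩, hκe⟩

/-! ### Polar coordinates for functions that split into an angular and a radial part -/

theorem lintegral_Ioi_comp_mul_left {c : ℝ} (hc : 0 < c) {F : ℝ → ℝ≥0∞} (hF : Measurable F) :
    ∫⁻ r in Ioi (0 : ℝ), F (c * r) = ENNReal.ofReal c⁻¹ * ∫⁻ r in Ioi (0 : ℝ), F r := by
  have hpre : (fun r : ℝ => c * r) ⁻¹' Ioi 0 = Ioi 0 := by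
    ext r; simp [hc]
  calc ∫⁻ r in Ioi (0 : ℝ), F (c * r)
      = ∫⁻ r in (fun r : ℝ => c * r) ⁻¹' Ioi 0, F (c * r) := by rw [hpre]
    _ = ∫⁻ r in Ioi (0 : ℝ), F r ∂(volume.map (c * ·)) :=
        (setLIntegral_map measurableSet_Ioi hF (by fun_prop)).symm
    _ = _ := by
        rw [Real.map_volume_mul_left hc.ne', Measure.restrict_smul, lintegral_smul_measure,
          abs_of_pos (inv_pos.2 hc), smul_eq_mul]

/-- Any norm will do. On `Fin N → ℝ` the sphere is that of the sup norm, which is harmless because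
only homogeneity along rays is used. -/
theorem lintegral_eq_lintegral_sphere {E : Type*} [NormedAddCommGroup E] [NormedSpace ℝ E]
    [MeasurableSpace E] [BorelSpace E] [FiniteDimensional ℝ E] [Nontrivial E] (μ : Measure E)
    [μ.IsAddHaarMeasure] {f : E → ℝ≥0∞} (hf : Measurable f) :
    ∫⁻ x, f x ∂μ = ∫⁻ w, ∫⁻ r in Ioi (0 : ℝ),
      ENNReal.ofReal (r ^ (Module.finrank ℝ E - 1)) * f (r • (w : E)) ∂volume ∂μ.toSphere := by
  have hmp := μ.measurePreserving_homeomorphUnitSphereProd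
  have hg : Measurable fun p : Metric.sphere (0 : E) 1 × Ioi (0 : ℝ) =>
      f ((p.2 : ℝ) • (p.1 : E)) := by fun_prop
  calc ∫⁻ x, f x ∂μ = ∫⁻ x : ({(0)}ᶜ : Set E), f x ∂(μ.comap (↑)) := by
        rw [lintegral_subtype_comap (measurableSet_singleton _).compl f,
          restrict_compl_singleton]
    _ = ∫⁻ p, f ((p.2 : ℝ) • (p.1 : E))
          ∂(μ.toSphere.prod (.volumeIoiPow (Module.finrank ℝ E - 1))) := by
        rw [← hmp.lintegral_comp hg]
        refine lintegral_congr fun x => ?_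
        have : (((homeomorphUnitSphereProd E) x).2 : ℝ) •
            (((homeomorphUnitSphereProd E) x).1 : E) = x := by
          simp only [homeomorphUnitSphereProd_apply_snd_coe,
            homeomorphUnitSphereProd_apply_fst_coe]
          rw [smul_smul, mul_inv_cancel₀ (norm_ne_zero_iff.2 x.2), one_smul]
        rw [this]
    _ = _ := by
        rw [lintegral_prod _ hg.aemeasurable]
        refine lintegral_congr fun w => ?_
        rw [Measure.volumeIoiPow, lintegral_withDensity_eq_lintegral_mul _ (by fun_prop)
          (by fun_prop)]
        exact lintegral_subtype_comap measurableSet_Ioi fun r : ℝ =>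
          ENNReal.ofReal (r ^ (Module.finrank ℝ E - 1)) * f (r • (w : E))

/-- If `A` is homogeneous of degree `0` and `s` of degree `2`, the integral of `A * φ (s)`
factorizes into an angular and a radial integral. -/
theorem lintegral_mul_comp_eq_mul {N : ℕ} (hN : N ≠ 0) {A : (Fin N → ℝ) → ℝ≥0∞}
    (hA : Measurable A) (hA0 : ∀ t > (0 : ℝ), ∀ g, A (t • g) = A g)
    {s : (Fin N → ℝ) → ℝ} (hs : Measurable s) (hspos : ∀ g, g ≠ 0 → 0 < s g)
    (hs2 : ∀ t > (0 : ℝ), ∀ g, s (t • g) = t ^ 2 * s g) {φ : ℝ → ℝ≥0∞} (hφ : Measurable φ) :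
    ∫⁻ g, A g * φ (s g) =
      (∫⁻ w, A (w : Fin N → ℝ) * ENNReal.ofReal ((√(s (w : Fin N → ℝ)))⁻¹ ^ N)
          ∂(volume : Measure (Fin N → ℝ)).toSphere) *
        ∫⁻ r in Ioi (0 : ℝ), ENNReal.ofReal (r ^ (N - 1)) * φ (r ^ 2) := by
  have : Nonempty (Fin N) := ⟨⟨0, Nat.pos_of_ne_zero hN⟩⟩
  rw [lintegral_eq_lintegral_sphere volume (by fun_prop), ← lintegral_mul_const _ (by fun_prop)]
  refine lintegral_congr fun w => ?_
  have hw : (w : Fin N → ℝ) ≠ 0 := fun h => by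
    have := w.2
    rw [h, mem_sphere_zero_iff_norm, norm_zero] at this
    norm_num at this
  have hc := Real.sqrt_pos.2 (hspos _ hw)
  set c := √(s (w : Fin N → ℝ)) with hcdef
  have hc2 : s (w : Fin N → ℝ) = c ^ 2 := (Real.sq_sqrt (hspos _ hw).le).symm
  rw [Module.finrank_fin_fun]
  -- On the ray through `w` one has `s (r w) = (c r)²`. The substitution `c r` frees the radial
  -- integral from `w` at the cost of `c⁻¹ ^ N`: `N - 1` factors from the Jacobian `r ^ (N - 1)` and
  -- one from `dr`.
  have e : ∀ r ∈ Ioi (0 : ℝ), ENNReal.ofReal (r ^ (N - 1)) *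
      (A (r • (w : Fin N → ℝ)) * φ (s (r • (w : Fin N → ℝ)))) =
      A (w : Fin N → ℝ) * ENNReal.ofReal (c⁻¹ ^ (N - 1)) *
        (fun r : ℝ => ENNReal.ofReal (r ^ (N - 1)) * φ (r ^ 2)) (c * r) := by
    intro r hr
    have hr' : (0 : ℝ) < r := hr
    rw [hA0 r hr, hs2 r hr, hc2]
    have h1 : r ^ (N - 1) = c⁻¹ ^ (N - 1) * (c * r) ^ (N - 1) := by
      rw [← mul_pow, inv_mul_cancel_left₀ hc.ne']
    rw [h1, ENNReal.ofReal_mul (by positivity), ← mul_pow, mul_comm r c]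
    ring
  rw [setLIntegral_congr_fun measurableSet_Ioi e, lintegral_const_mul _ (by fun_prop),
    lintegral_Ioi_comp_mul_left hc
      (F := fun r : ℝ => ENNReal.ofReal (r ^ (N - 1)) * φ (r ^ 2)) (by fun_prop),
    ← mul_assoc, mul_assoc (A _),
    ← ENNReal.ofReal_mul (by positivity), ← pow_succ, Nat.sub_add_cancel (Nat.pos_of_ne_zero hN)]

/-! ### Product Gaussian measures -/

theorem pi_withDensity_ofReal {ι : Type*} [Fintype ι] {f : ι → ℝ → ℝ} (hf0 : ∀ i x, 0 ≤ f i x)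
    (hfi : ∀ i, Integrable (f i)) :
    Measure.pi (fun i => volume.withDensity fun x => ENNReal.ofReal (f i x)) =
      (volume : Measure (ι → ℝ)).withDensity fun x => ENNReal.ofReal (∏ i, f i (x i)) := by
  have hfin : ∀ i, IsFiniteMeasure (volume.withDensity fun x => ENNReal.ofReal (f i x)) :=
    fun i => isFiniteMeasure_withDensity_ofReal (hfi i).2
  refine Measure.pi_eq fun s hs => ?_
  rw [withDensity_apply _ (MeasurableSet.univ_pi hs), volume_pi, Measure.restrict_pi_pi,
    ← ofReal_integral_eq_lintegral_ofReal, integral_fintype_prod_eq_prod,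
    ENNReal.ofReal_prod_of_nonneg]
  · refine Finset.prod_congr rfl fun i _ => ?_
    rw [withDensity_apply _ (hs i), ← ofReal_integral_eq_lintegral_ofReal (hfi i).integrableOn
      (ae_of_all _ (hf0 i))]
  · exact fun i _ => integral_nonneg (hf0 i)
  · exact Integrable.fintype_prod_dep fun i => (hfi i).integrableOn
  · exact ae_of_all _ fun x => Finset.prod_nonneg fun i _ => hf0 i _

/-- The law of independent centred Gaussians with variances `1 / l i`. -/
noncomputable def gaussianPi {ι : Type*} [Fintype ι] (l : ι → ℝ) : Measure (ι → ℝ) :=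
  Measure.pi fun i => gaussianReal 0 (Real.toNNReal (1 / l i))

instance {ι : Type*} [Fintype ι] (l : ι → ℝ) : IsProbabilityMeasure (gaussianPi l) := by
  unfold gaussianPi; infer_instance

instance (N : ℕ) : IsProbabilityMeasure (stdNormal N) := by
  unfold stdNormal; infer_instance

theorem stdNormal_eq_gaussianPi (N : ℕ) : stdNormal N = gaussianPi fun _ => 1 := by
  simp [stdNormal, gaussianPi]

/-- The diagonal quadratic form `∑ i, l i * g i ^ 2`. -/
noncomputable def quad {ι : Type*} [Fintype ι] (l g : ι → ℝ) : ℝ := ∑ i, l i * g i ^ 2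

@[fun_prop]
theorem measurable_quad {ι : Type*} [Fintype ι] (l : ι → ℝ) : Measurable (quad l) := by
  unfold quad; fun_prop

theorem quad_smul {ι : Type*} [Fintype ι] (l : ι → ℝ) (t : ℝ) (g : ι → ℝ) :
    quad l (t • g) = t ^ 2 * quad l g := by
  simp only [quad, Pi.smul_apply, smul_eq_mul, Finset.mul_sum]
  exact Finset.sum_congr rfl fun i _ => by ring

theorem quad_pos {ι : Type*} [Fintype ι] {l g : ι → ℝ} (hl : ∀ i, 0 < l i) (hg : g ≠ 0) :
    0 < quad l g := by
  obtain ⟨i, hi⟩ := Function.ne_iff.1 hg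
  exact Finset.sum_pos' (fun j _ => mul_nonneg (hl j).le (sq_nonneg _))
    ⟨i, Finset.mem_univ _, mul_pos (hl i) (sq_pos_of_ne_zero hi)⟩

theorem exists_gaussianPi_eq_withDensity {ι : Type*} [Fintype ι] {l : ι → ℝ} (hl : ∀ i, 0 < l i) :
    ∃ C : ℝ, 0 < C ∧ gaussianPi l = (volume : Measure (ι → ℝ)).withDensity fun g =>
      ENNReal.ofReal (C * Real.exp (-(quad l g) / 2)) := by
  have hv : ∀ i, Real.toNNReal (1 / l i) ≠ 0 := fun i => by
    simpa using hl i
  refine ⟨∏ i, (√(2 * Real.pi * Real.toNNReal (1 / l i)))⁻¹, ?_, ?_⟩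
  · refine Finset.prod_pos fun i _ => inv_pos.2 (Real.sqrt_pos.2 ?_)
    have : (0 : ℝ) < Real.toNNReal (1 / l i) := by
      exact_mod_cast pos_iff_ne_zero.2 (hv i)
    positivity
  · have h := pi_withDensity_ofReal (ι := ι)
      (f := fun i => gaussianPDFReal 0 (Real.toNNReal (1 / l i)))
      (fun i x => gaussianPDFReal_nonneg _ _ _)
      (fun i => integrable_gaussianPDFReal _ _)
    have e : gaussianPi l = Measure.pi fun i => volume.withDensity fun x =>
        ENNReal.ofReal (gaussianPDFReal 0 (Real.toNNReal (1 / l i)) x) := by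
      unfold gaussianPi
      congr 1
      funext i
      rw [gaussianReal_of_var_ne_zero _ (hv i)]
      rfl
    rw [e, h]
    congr 1
    funext g
    congr 1
    simp only [gaussianPDFReal_def, Finset.prod_mul_distrib, ← Real.exp_sum]
    congr 2
    rw [quad, neg_div, Finset.sum_div, ← Finset.sum_neg_distrib]
    refine Finset.sum_congr rfl fun i _ => ?_
    rw [Real.coe_toNNReal _ (one_div_pos.2 (hl i)).le]
    have := (hl i).ne'
    field_simp
    ring

theorem ae_ne_zero_stdNormal {N : ℕ} (hN : N ≠ 0) : ∀ᵐ g ∂(stdNormal N), g ≠ 0 := by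
  have : Nonempty (Fin N) := ⟨⟨0, Nat.pos_of_ne_zero hN⟩⟩
  obtain ⟨C, -, hC⟩ := exists_gaussianPi_eq_withDensity (ι := Fin N) (l := fun _ => 1)
    fun _ => one_pos
  rw [stdNormal_eq_gaussianPi, hC]
  exact (withDensity_absolutelyContinuous _ _).ae_le
    (compl_mem_ae_iff.2 (measure_singleton (0 : Fin N → ℝ)))

/-- The ratio `∑ l i * g i ^ 2 / ∑ g i ^ 2`. -/
noncomputable def rayleigh {N : ℕ} (l g : Fin N → ℝ) : ℝ := quad l g / quad (fun _ => 1) g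

@[fun_prop]
theorem measurable_rayleigh {N : ℕ} (l : Fin N → ℝ) : Measurable (rayleigh l) := by
  unfold rayleigh; fun_prop

theorem rayleigh_smul {N : ℕ} (l : Fin N → ℝ) {t : ℝ} (ht : 0 < t) (g : Fin N → ℝ) :
    rayleigh l (t • g) = rayleigh l g := by
  rw [rayleigh, rayleigh, quad_smul, quad_smul, mul_div_mul_left _ _ (pow_pos ht 2).ne']

theorem rayleigh_mem {N : ℕ} {l g : Fin N → ℝ} {m M : ℝ} (hm : ∀ i, m ≤ l i) (hM : ∀ i, l i ≤ M)
    (hg : g ≠ 0) : rayleigh l g ∈ Icc m M := by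
  have h1 : 0 < quad (fun _ => 1) g := quad_pos (fun _ => one_pos) hg
  rw [rayleigh, mem_Icc, le_div_iff₀ h1, div_le_iff₀ h1, quad, quad, Finset.mul_sum, Finset.mul_sum]
  constructor <;> refine Finset.sum_le_sum fun i _ => ?_
  · rw [one_mul]; exact mul_le_mul_of_nonneg_right (hm i) (sq_nonneg _)
  · rw [one_mul]; exact mul_le_mul_of_nonneg_right (hM i) (sq_nonneg _)

/-- The direction and the length of `g` decouple: for `A` homogeneous of degree `0`, the integral
of `A * ψ (quad l)` under `gaussianPi l` is the product of an angular integral and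
a radial integral, both against the standard normal measure. -/
theorem exists_integral_gaussianPi_eq {N : ℕ} (hN : N ≠ 0) {l : Fin N → ℝ} (hl : ∀ i, 0 < l i) :
    ∃ κ : ℝ, 0 < κ ∧ ∀ A : (Fin N → ℝ) → ℝ, Measurable A → (∀ g, 0 ≤ A g) →
      (∀ t > (0 : ℝ), ∀ g, A (t • g) = A g) → ∀ ψ : ℝ → ℝ, Measurable ψ → (∀ x, 0 ≤ ψ x) →
      ∫ g, A g * ψ (quad l g) ∂(gaussianPi l) =
        κ * (∫ g, A g * (√(rayleigh l g))⁻¹ ^ N ∂(stdNormal N)) *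
          ∫ g, ψ (quad (fun _ => 1) g) ∂(stdNormal N) := by
  obtain ⟨C, hC, hCe⟩ := exists_gaussianPi_eq_withDensity hl
  obtain ⟨D, hD, hDe⟩ := exists_gaussianPi_eq_withDensity (ι := Fin N) (l := fun _ => 1)
    fun _ => one_pos
  rw [← stdNormal_eq_gaussianPi] at hDe
  have one1 : ∀ i : Fin N, (0 : ℝ) < (fun _ => 1 : Fin N → ℝ) i := fun _ => one_pos
  -- the factorization for a Gaussian density
  have key : ∀ {a : Fin N → ℝ} {c : ℝ}, (∀ i, 0 < a i) → 0 < c →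
      ∀ A : (Fin N → ℝ) → ℝ≥0∞, Measurable A → (∀ t > (0 : ℝ), ∀ g, A (t • g) = A g) →
      ∀ ψ : ℝ → ℝ≥0∞, Measurable ψ →
      ∫⁻ g, A g * ψ (quad a g) ∂((volume : Measure (Fin N → ℝ)).withDensity fun g =>
        ENNReal.ofReal (c * Real.exp (-(quad a g) / 2))) =
      ENNReal.ofReal c * ((∫⁻ w, A (w : Fin N → ℝ) *
          ENNReal.ofReal ((√(quad a (w : Fin N → ℝ)))⁻¹ ^ N)
            ∂(volume : Measure (Fin N → ℝ)).toSphere) *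
        ∫⁻ r in Ioi (0 : ℝ), ENNReal.ofReal (r ^ (N - 1)) *
          (ENNReal.ofReal (Real.exp (-(r ^ 2) / 2)) * ψ (r ^ 2))) := by
    intro a c ha hc A hA hA0 ψ hψ
    rw [lintegral_withDensity_eq_lintegral_mul _ (by fun_prop) (by fun_prop),
      ← lintegral_mul_comp_eq_mul hN hA hA0 (measurable_quad a) (fun g hg => quad_pos ha hg)
        (fun t _ g => quad_smul a t g)
        (φ := fun x => ENNReal.ofReal (Real.exp (-x / 2)) * ψ x) (by fun_prop),
      ← lintegral_const_mul _ (by fun_prop)]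
    refine lintegral_congr fun g => ?_
    rw [Pi.mul_apply, ENNReal.ofReal_mul hc.le]
    ring
  refine ⟨C / D, div_pos hC hD, fun A hA hA0 hAh ψ hψ hψ0 => ?_⟩
  have hτm : Measurable fun g => (√(rayleigh l g))⁻¹ ^ N := by fun_prop
  have hτ0 : ∀ g, 0 ≤ (√(rayleigh l g))⁻¹ ^ N := fun g => by positivity
  rw [integral_eq_lintegral_of_nonneg_ae (ae_of_all _ fun g => mul_nonneg (hA0 g) (hψ0 _))
      (by fun_prop),
    integral_eq_lintegral_of_nonneg_ae (ae_of_all _ fun g => mul_nonneg (hA0 g) (hτ0 _))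
      (by fun_prop),
    integral_eq_lintegral_of_nonneg_ae (ae_of_all _ fun g => hψ0 _)
      (hψ.comp (measurable_quad _)).aestronglyMeasurable]
  have e0 : ENNReal.toReal (ENNReal.ofReal (C / D)) = C / D :=
    ENNReal.toReal_ofReal (div_pos hC hD).le
  rw [← e0, ← ENNReal.toReal_mul, ← ENNReal.toReal_mul]
  congr 1
  have hmul : ∀ g (y : ℝ), ENNReal.ofReal (A g * y) = ENNReal.ofReal (A g) * ENNReal.ofReal y :=
    fun g y => ENNReal.ofReal_mul (hA0 g)
  simp only [hmul]
  -- `k1` treats the left side, `k2` the angular and `k3` the radial integral on the right. `k4`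
  -- expresses that the standard normal measure has mass `1`, which removes the superfluous angular
  -- and radial constants.
  have k1 := key hl hC (fun g => ENNReal.ofReal (A g)) (by fun_prop)
    (fun t ht g => by rw [hAh t ht]) (fun x => ENNReal.ofReal (ψ x)) (by fun_prop)
  have k2 := key one1 hD
    (fun g => ENNReal.ofReal (A g) * ENNReal.ofReal ((√(rayleigh l g))⁻¹ ^ N)) (by fun_prop)
    (fun t ht g => by rw [hAh t ht, rayleigh_smul l ht]) (fun _ => 1) (by fun_prop)
  have k3 := key one1 hD (fun _ => 1) (by fun_prop) (fun t ht g => rfl)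
    (fun x => ENNReal.ofReal (ψ x)) (by fun_prop)
  have k4 := key one1 hD (fun _ => 1) (by fun_prop) (fun t ht g => rfl)
    (fun _ => 1) (by fun_prop)
  simp only [← hDe, ← hCe, one_mul, mul_one, lintegral_const, measure_univ] at k1 k2 k3 k4
  -- The Rayleigh quotient is exactly the density that converts the angular law of the standard
  -- normal into that of precisions `l`: `rayleigh l * quad 1 = quad l`.
  have e1 : ∫⁻ w, ENNReal.ofReal (A (w : Fin N → ℝ)) *
        ENNReal.ofReal ((√(rayleigh l (w : Fin N → ℝ)))⁻¹ ^ N) *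
        ENNReal.ofReal ((√(quad (fun _ => 1) (w : Fin N → ℝ)))⁻¹ ^ N)
          ∂(volume : Measure (Fin N → ℝ)).toSphere =
      ∫⁻ w, ENNReal.ofReal (A (w : Fin N → ℝ)) *
        ENNReal.ofReal ((√(quad l (w : Fin N → ℝ)))⁻¹ ^ N)
          ∂(volume : Measure (Fin N → ℝ)).toSphere := by
    refine lintegral_congr fun w => ?_
    have hw : (w : Fin N → ℝ) ≠ 0 := fun h => by
      have := w.2
      rw [h, mem_sphere_zero_iff_norm, norm_zero] at this
      norm_num at this
    have hq1 := quad_pos one1 hw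
    have hq := quad_pos hl hw
    rw [mul_assoc, ← ENNReal.ofReal_mul (by positivity), ← mul_pow, ← mul_inv,
      rayleigh, ← Real.sqrt_mul (div_pos hq hq1).le, div_mul_cancel₀ _ hq1.ne']
  rw [e1] at k2
  rw [k1, k2, k3]
  generalize (∫⁻ w, ENNReal.ofReal (A (w : Fin N → ℝ)) *
        ENNReal.ofReal ((√(quad l (w : Fin N → ℝ)))⁻¹ ^ N)
          ∂(volume : Measure (Fin N → ℝ)).toSphere) = J at *
  have hCD : ENNReal.ofReal C = ENNReal.ofReal (C / D) * ENNReal.ofReal D := by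
    rw [← ENNReal.ofReal_mul (div_pos hC hD).le, div_mul_cancel₀ _ hD.ne']
  rw [hCD]
  set I1 := ∫⁻ r in Ioi (0 : ℝ), ENNReal.ofReal (r ^ (N - 1)) *
    ENNReal.ofReal (Real.exp (-(r ^ 2) / 2))
  set I2 := ∫⁻ r in Ioi (0 : ℝ), ENNReal.ofReal (r ^ (N - 1)) *
    (ENNReal.ofReal (Real.exp (-(r ^ 2) / 2)) * ENNReal.ofReal (ψ (r ^ 2)))
  set J1 := ∫⁻ w, ENNReal.ofReal ((√(quad (fun _ => 1) (w : Fin N → ℝ)))⁻¹ ^ N)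
    ∂(volume : Measure (Fin N → ℝ)).toSphere
  calc ENNReal.ofReal (C / D) * ENNReal.ofReal D * (J * I2)
      = ENNReal.ofReal (C / D) * (ENNReal.ofReal D * (J * I2)) * 1 := by ring
    _ = _ := by rw [k4]; ring

/-! ### Moments of quadratic forms -/

/-- The fourth moment of the standard normal law. -/
noncomputable def normalFourthMoment : ℝ := ∫ x, x ^ 4 ∂(gaussianReal 0 1)

theorem integrable_pow_gaussianReal (n : ℕ) (v : ℝ≥0) :
    Integrable (fun x : ℝ => x ^ n) (gaussianReal 0 v) := by
  have h := (memLp_id_gaussianReal (μ := 0) (v := v) (n : ℝ≥0)).integrable_norm_pow'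
  refine (integrable_norm_iff (by fun_prop)).1 ?_
  simpa [norm_pow] using h

theorem normalFourthMoment_nonneg : 0 ≤ normalFourthMoment :=
  integral_nonneg fun x => by positivity

theorem integral_sq_gaussianReal (v : ℝ≥0) : ∫ x, x ^ 2 ∂(gaussianReal 0 v) = v := by
  have h := variance_fun_id_gaussianReal (μ := 0) (v := v)
  rwa [variance_of_integral_eq_zero (by fun_prop) integral_id_gaussianReal] at h

theorem gaussianReal_eq_map (v : ℝ≥0) :
    gaussianReal 0 v = (gaussianReal 0 1).map fun x => √(v : ℝ) * x := by
  have h := gaussianReal_map_const_mul (μ := 0) (v := 1) (√(v : ℝ))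
  have e : NNReal.mk (√(v : ℝ) ^ 2) (sq_nonneg _) * 1 = v := by
    ext; simp
  rw [mul_zero, e] at h
  exact h.symm

theorem integral_pow_four_gaussianReal (v : ℝ≥0) :
    ∫ x, x ^ 4 ∂(gaussianReal 0 v) = (v : ℝ) ^ 2 * normalFourthMoment := by
  rw [gaussianReal_eq_map, integral_map (by fun_prop) (by fun_prop), normalFourthMoment,
    ← integral_const_mul]
  refine integral_congr_ae (ae_of_all _ fun x => ?_)
  have : √(v : ℝ) ^ 4 = (v : ℝ) ^ 2 := by
    rw [show 4 = 2 * 2 from rfl, pow_mul, Real.sq_sqrt v.coe_nonneg]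
  simp only [mul_pow, this]

theorem memLp_const_mul_sq_gaussianReal (a : ℝ) (v : ℝ≥0) :
    MemLp (fun x : ℝ => a * x ^ 2) 2 (gaussianReal 0 v) := by
  refine (memLp_two_iff_integrable_sq (by fun_prop)).2 ?_
  simpa only [mul_pow, ← pow_mul] using (integrable_pow_gaussianReal 4 v).const_mul (a ^ 2)

theorem memLp_quad_gaussianPi {ι : Type*} [Fintype ι] (l a : ι → ℝ) :
    MemLp (quad a) 2 (gaussianPi l) := by
  unfold quad
  refine memLp_finsetSum _ fun i _ => ?_
  exact (memLp_const_mul_sq_gaussianReal (a i) _).comp_measurePreserving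
    (measurePreserving_eval (fun i => gaussianReal 0 (Real.toNNReal (1 / l i))) i)

theorem integral_quad_gaussianPi {ι : Type*} [Fintype ι] {l : ι → ℝ} (hl : ∀ i, 0 < l i)
    (a : ι → ℝ) : ∫ g, quad a g ∂(gaussianPi l) = ∑ i, a i / l i := by
  have hint : ∀ i, Integrable (fun g : ι → ℝ => a i * g i ^ 2) (gaussianPi l) := fun i =>
    integrable_comp_eval (μ := fun i => gaussianReal 0 (Real.toNNReal (1 / l i)))
      (f := fun x : ℝ => a i * x ^ 2)
      ((integrable_pow_gaussianReal 2 _).const_mul _)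
  unfold quad
  rw [integral_finsetSum _ fun i _ => hint i]
  refine Finset.sum_congr rfl fun i _ => ?_
  have := integral_comp_eval (μ := fun i => gaussianReal 0 (Real.toNNReal (1 / l i))) (i := i)
    (f := fun x : ℝ => a i * x ^ 2) (by fun_prop)
  rw [gaussianPi, this, integral_const_mul, integral_sq_gaussianReal,
    Real.coe_toNNReal _ (one_div_pos.2 (hl i)).le, mul_one_div]

/-- Independence makes the variance additive, and each term is bounded by its second moment. The
loss is immaterial: only the order of magnitude is needed, so the numerical value of the fourth
moment never enters. -/
theorem variance_quad_gaussianPi_le {ι : Type*} [Fintype ι] {l : ι → ℝ} (hl : ∀ i, 0 < l i)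
    (a : ι → ℝ) :
    Var[quad a; gaussianPi l] ≤ normalFourthMoment * ∑ i, (a i / l i) ^ 2 := by
  have e : quad a = ∑ i, fun g : ι → ℝ => a i * g i ^ 2 := by
    funext g; simp [quad]
  rw [e, gaussianPi, variance_sum_pi (X := fun i x => a i * x ^ 2)
    fun i => memLp_const_mul_sq_gaussianReal (a i) _, Finset.mul_sum]
  refine Finset.sum_le_sum fun i _ => (variance_le_expectation_sq (by fun_prop)).trans_eq ?_
  simp only [Pi.pow_apply, mul_pow, ← pow_mul]
  rw [integral_const_mul, integral_pow_four_gaussianReal,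
    Real.coe_toNNReal _ (one_div_pos.2 (hl i)).le]
  ring

theorem integral_pow_four_gaussianPi {ι : Type*} [Fintype ι] {l : ι → ℝ} (hl : ∀ i, 0 < l i)
    (i : ι) : ∫ g, g i ^ 4 ∂(gaussianPi l) = normalFourthMoment / l i ^ 2 := by
  have := integral_comp_eval (μ := fun i => gaussianReal 0 (Real.toNNReal (1 / l i))) (i := i)
    (f := fun x : ℝ => x ^ 4) (by fun_prop)
  rw [gaussianPi, this, integral_pow_four_gaussianReal,
    Real.coe_toNNReal _ (one_div_pos.2 (hl i)).le]
  ring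

theorem integrable_pow_four_gaussianPi {ι : Type*} [Fintype ι] (l : ι → ℝ) (i : ι) :
    Integrable (fun g : ι → ℝ => g i ^ 4) (gaussianPi l) :=
  integrable_comp_eval (μ := fun i => gaussianReal 0 (Real.toNNReal (1 / l i)))
    (f := fun x : ℝ => x ^ 4) (integrable_pow_gaussianReal 4 _)

/-! ### Exponential tilting by a bounded function -/

theorem integrable_exp_of_bounded {Ω : Type*} {mΩ : MeasurableSpace Ω} {μ : Measure Ω}
    [IsFiniteMeasure μ] {u : Ω → ℝ} (hu : Measurable u) {B : ℝ} (hB : ∀ x, u x ≤ B) :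
    Integrable (fun x => Real.exp (u x)) μ :=
  Integrable.of_bound (by fun_prop) (Real.exp B) (ae_of_all _ fun x => by
    rw [Real.norm_eq_abs, Real.abs_exp]; exact Real.exp_le_exp.2 (hB x))

theorem integrable_tilted_of_bounded {Ω : Type*} {mΩ : MeasurableSpace Ω} {μ : Measure Ω}
    [IsFiniteMeasure μ] {u : Ω → ℝ} (hu : Measurable u) {B : ℝ} (hB : ∀ x, u x ≤ B)
    {f : Ω → ℝ} (hf : Integrable f μ) : Integrable f (μ.tilted u) := by
  rw [integrable_tilted_iff (integrable_exp_of_bounded hu hB)]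
  refine hf.bdd_mul (c := Real.exp B) (by fun_prop) (ae_of_all _ fun x => ?_)
  rw [Real.norm_eq_abs, Real.abs_exp]; exact Real.exp_le_exp.2 (hB x)

theorem integral_tilted_eq_div {Ω : Type*} {mΩ : MeasurableSpace Ω} {μ : Measure Ω}
    (u f : Ω → ℝ) :
    ∫ x, f x ∂(μ.tilted u) = (∫ x, f x * Real.exp (u x) ∂μ) / ∫ x, Real.exp (u x) ∂μ := by
  rw [integral_tilted, div_eq_inv_mul, ← integral_const_mul]
  refine integral_congr_ae (ae_of_all _ fun x => ?_)
  simp only [smul_eq_mul]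
  ring

theorem tilted_add_const {Ω : Type*} {mΩ : MeasurableSpace Ω} (μ : Measure Ω) (u : Ω → ℝ)
    (c : ℝ) : μ.tilted (fun x => u x + c) = μ.tilted u := by
  unfold Measure.tilted
  congr 1
  funext x
  congr 1
  simp only [Real.exp_add, integral_mul_const]
  rw [mul_div_mul_right _ _ (Real.exp_pos c).ne']

/-! ### The direction under the Gibbs weight is dominated by that of a Gaussian vector -/

/-- The law with density proportional to `exp (N (1 - rayleigh l) / 2)` with respect to
the standard normal measure. -/
noncomputable def rayleighGibbs {N : ℕ} (l : Fin N → ℝ) : Measure (Fin N → ℝ) :=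
  (stdNormal N).tilted fun g => N * (1 - rayleigh l g) / 2

theorem rayleigh_nonneg {N : ℕ} {l : Fin N → ℝ} (hl : ∀ i, 0 < l i) (g : Fin N → ℝ) :
    0 ≤ rayleigh l g :=
  div_nonneg (Finset.sum_nonneg fun i _ => mul_nonneg (hl i).le (sq_nonneg _))
    (Finset.sum_nonneg fun _ _ => mul_nonneg one_pos.le (sq_nonneg _))

theorem rayleigh_zero {N : ℕ} (l : Fin N → ℝ) : rayleigh l 0 = 0 := by
  simp [rayleigh, quad]

theorem exponent_le {N : ℕ} {l : Fin N → ℝ} (hl : ∀ i, 0 < l i) (g : Fin N → ℝ) :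
    N * (1 - rayleigh l g) / 2 ≤ N / 2 := by
  have := mul_nonneg (Nat.cast_nonneg (α := ℝ) N) (rayleigh_nonneg hl g)
  linarith

theorem isProbabilityMeasure_rayleighGibbs {N : ℕ} {l : Fin N → ℝ} (hl : ∀ i, 0 < l i) :
    IsProbabilityMeasure (rayleighGibbs l) :=
  isProbabilityMeasure_tilted (integrable_exp_of_bounded (by fun_prop) (exponent_le hl))

theorem integral_mul_comp_quad_stdNormal {N : ℕ} (hN : N ≠ 0) {A : (Fin N → ℝ) → ℝ}
    (hA : Measurable A) (hA0 : ∀ g, 0 ≤ A g) (hAh : ∀ t > (0 : ℝ), ∀ g, A (t • g) = A g)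
    {ψ : ℝ → ℝ} (hψ : Measurable ψ) (hψ0 : ∀ x, 0 ≤ ψ x) :
    ∫ g, A g * ψ (quad (fun _ => 1) g) ∂(stdNormal N) =
      (∫ g, A g ∂(stdNormal N)) * ∫ g, ψ (quad (fun _ => 1) g) ∂(stdNormal N) := by
  obtain ⟨κ, -, h⟩ := exists_integral_gaussianPi_eq hN (l := fun _ => 1) fun _ => one_pos
  -- The choice `ψ = 1` in `h2` identifies the angular factor of `h1` with the mean of `A`, so
  -- neither `κ` nor the Rayleigh quotient has to be evaluated.
  have h1 := h A hA hA0 hAh ψ hψ hψ0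
  have h2 := h A hA hA0 hAh (fun _ => 1) measurable_const fun _ => zero_le_one
  rw [← stdNormal_eq_gaussianPi] at h1 h2
  simp only [mul_one, integral_const, probReal_univ, smul_eq_mul] at h2
  rw [h1, ← h2]

/-- Under the Gibbs weight the squared length is independent of the direction, and keeps its law. -/
theorem integral_mul_comp_quad_rayleighGibbs {N : ℕ} (hN : N ≠ 0) (l : Fin N → ℝ)
    {A : (Fin N → ℝ) → ℝ}
    (hA : Measurable A) (hA0 : ∀ g, 0 ≤ A g) (hAh : ∀ t > (0 : ℝ), ∀ g, A (t • g) = A g)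
    {ψ : ℝ → ℝ} (hψ : Measurable ψ) (hψ0 : ∀ x, 0 ≤ ψ x) :
    ∫ g, A g * ψ (quad (fun _ => 1) g) ∂(rayleighGibbs l) =
      (∫ g, A g ∂(rayleighGibbs l)) * ∫ g, ψ (quad (fun _ => 1) g) ∂(stdNormal N) := by
  have h := integral_mul_comp_quad_stdNormal hN
    (A := fun g => A g * Real.exp (N * (1 - rayleigh l g) / 2)) (by fun_prop)
    (fun g => mul_nonneg (hA0 g) (Real.exp_pos _).le)
    (fun t ht g => by rw [hAh t ht, rayleigh_smul l ht]) hψ hψ0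
  rw [rayleighGibbs, integral_tilted_eq_div, integral_tilted_eq_div, div_mul_eq_mul_div, ← h]
  congr 1
  exact integral_congr_ae (ae_of_all _ fun g => by ring)

/-- This is `log x ≤ x - 1`: the Gibbs weight lies below the Gaussian angular density. -/
theorem exp_le_inv_sqrt_pow {x : ℝ} (hx : 0 < x) (N : ℕ) :
    Real.exp (N * (1 - x) / 2) ≤ (√x)⁻¹ ^ N := by
  rw [mul_div_assoc, Real.exp_nat_mul]
  refine pow_le_pow_left₀ (Real.exp_pos _).le ?_ N
  have h : √x ≤ Real.exp ((x - 1) / 2) := by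
    rw [Real.exp_half]
    exact Real.sqrt_le_sqrt (by linarith [Real.add_one_le_exp (x - 1)])
  rw [show (1 - x) / 2 = -((x - 1) / 2) by ring, Real.exp_neg]
  exact inv_anti₀ (Real.sqrt_pos.2 hx) h

/-- The reverse comparison, with a loss quadratic in `x - 1`. It uses `log (1/x) ≤ 1/x - 1` and the
identity `(1/x - 1) - (x - 1)² / x = 1 - x`. -/
theorem inv_sqrt_pow_mul_exp_le {x m : ℝ} (hm : 0 < m) (hx : m ≤ x) (N : ℕ) :
    (√x)⁻¹ ^ N * Real.exp (-(N * (x - 1) ^ 2 / (2 * m))) ≤ Real.exp (N * (1 - x) / 2) := by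
  have hx0 : 0 < x := hm.trans_le hx
  have h1 : (√x)⁻¹ ≤ Real.exp ((x⁻¹ - 1) / 2) := by
    rw [Real.exp_half, ← Real.sqrt_inv]
    exact Real.sqrt_le_sqrt (by linarith [Real.add_one_le_exp (x⁻¹ - 1)])
  calc (√x)⁻¹ ^ N * Real.exp (-(N * (x - 1) ^ 2 / (2 * m)))
      ≤ Real.exp ((x⁻¹ - 1) / 2) ^ N * Real.exp (-(N * (x - 1) ^ 2 / (2 * x))) := by
        gcongr
    _ = Real.exp (N * (1 - x) / 2) := by
        rw [← Real.exp_nat_mul, ← Real.exp_add]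
        congr 1
        field_simp
        ring

section Domination

variable {N : ℕ} {l : Fin N → ℝ} {m M : ℝ}

/-- The saddle point condition `hsum` gives `quad l` and the squared length the same mean `N`, so
the second moment is a variance, of order `N` rather than `N²`. -/
theorem integral_sq_quad_sub_le (hm : 0 < m) (hml : ∀ i, m ≤ l i) (hsum : ∑ i, 1 / l i = N) :
    ∫ g, (quad l g - quad (fun _ => 1) g) ^ 2 ∂(gaussianPi l) ≤
      normalFourthMoment * (1 + 1 / m) ^ 2 * N := by
  have hl : ∀ i, 0 < l i := fun i => hm.trans_le (hml i)
  have e : ∀ g, quad l g - quad (fun _ => 1) g = quad (fun i => l i - 1) g := fun g => by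
    simp only [quad, ← Finset.sum_sub_distrib]
    exact Finset.sum_congr rfl fun i _ => by ring
  have h0 : ∫ g, quad (fun i => l i - 1) g ∂(gaussianPi l) = 0 := by
    rw [integral_quad_gaussianPi hl]
    have : ∀ i, (l i - 1) / l i = 1 - 1 / l i := fun i => by
      rw [sub_div, div_self (hl i).ne']
    simp [this, Finset.sum_sub_distrib, ← hsum]
  simp only [e]
  rw [← variance_of_integral_eq_zero (by fun_prop) h0]
  refine (variance_quad_gaussianPi_le hl _).trans ?_
  rw [mul_assoc]
  refine mul_le_mul_of_nonneg_left ?_ normalFourthMoment_nonneg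
  calc ∑ i, ((l i - 1) / l i) ^ 2 ≤ ∑ _i : Fin N, (1 + 1 / m) ^ 2 := by
        refine Finset.sum_le_sum fun i _ => ?_
        rw [sub_div, div_self (hl i).ne']
        have h1 : 1 / l i ≤ 1 / m := one_div_le_one_div_of_le hm (hml i)
        have h2 : 0 < 1 / l i := one_div_pos.2 (hl i)
        exact sq_le_sq' (by linarith) (by linarith)
    _ = _ := by simp [mul_comm]

theorem integrable_sq_quad_sub (a : Fin N → ℝ) (c : ℝ) :
    Integrable (fun g => (quad a g - c) ^ 2) (gaussianPi l) :=
  ((memLp_quad_gaussianPi l a).sub (memLp_const c)).integrable_sq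

theorem integral_quad_one_stdNormal : ∫ g, quad (fun _ => 1) g ∂(stdNormal N) = N := by
  rw [stdNormal_eq_gaussianPi, integral_quad_gaussianPi fun _ => one_pos]
  simp

theorem variance_quad_one_stdNormal_le :
    Var[quad (fun _ => 1); stdNormal N] ≤ normalFourthMoment * N := by
  rw [stdNormal_eq_gaussianPi]
  exact (variance_quad_gaussianPi_le (fun _ => one_pos) _).trans_eq (by simp)

theorem integral_sq_quad_one_stdNormal :
    ∫ g, quad (fun _ => 1) g ^ 2 ∂(stdNormal N) = Var[quad (fun _ => 1); stdNormal N] + N ^ 2 := by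
  have h : MemLp (quad fun _ => (1 : ℝ)) 2 (stdNormal N) := by
    rw [stdNormal_eq_gaussianPi]; exact memLp_quad_gaussianPi _ _
  rw [variance_eq_sub h, integral_quad_one_stdNormal]
  simp

/-- The domination constant of `integral_rayleighGibbs_le`. -/
noncomputable def dominationConst (m M : ℝ) : ℝ :=
  Real.exp (M ^ 2 * (normalFourthMoment * (1 + 1 / m) ^ 2) / (2 * m)) * M ^ 2

/-- The factor `quad 1 ^ 2 / N ^ 2` is there so that, for the intended `A`, the right side is a
polynomial moment of a Gaussian vector; no inverse moments of the length are needed. -/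
theorem integral_rayleighGibbs_le (hN : N ≠ 0) (hm : 0 < m) (hml : ∀ i, m ≤ l i)
    (hlM : ∀ i, l i ≤ M) (hsum : ∑ i, 1 / l i = N) {A : (Fin N → ℝ) → ℝ} (hA : Measurable A)
    (hA0 : ∀ g, 0 ≤ A g) (hAh : ∀ t > (0 : ℝ), ∀ g, A (t • g) = A g) {B : ℝ} (hAB : ∀ g, A g ≤ B)
    (hAi : Integrable (fun g => A g * quad (fun _ => 1) g ^ 2) (gaussianPi l)) :
    ∫ g, A g ∂(rayleighGibbs l) ≤ dominationConst m M / (N : ℝ) ^ 2 *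
      ∫ g, A g * quad (fun _ => 1) g ^ 2 ∂(gaussianPi l) := by
  have hl : ∀ i, 0 < l i := fun i => hm.trans_le (hml i)
  have hNr : (0 : ℝ) < N := by exact_mod_cast Nat.pos_of_ne_zero hN
  have hM : 0 < M := (hl ⟨0, Nat.pos_of_ne_zero hN⟩).trans_le (hlM _)
  have hne := ae_ne_zero_stdNormal hN
  obtain ⟨κ, hκ, hfac⟩ := exists_integral_gaussianPi_eq hN hl
  set G := stdNormal N
  set σ : (Fin N → ℝ) → ℝ := rayleigh l with hσ
  set τ : (Fin N → ℝ) → ℝ := fun g => (√(σ g))⁻¹ ^ N with hτ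
  set W : (Fin N → ℝ) → ℝ := fun g => Real.exp (N * (1 - σ g) / 2) with hW
  set C₂ : ℝ := normalFourthMoment * (1 + 1 / m) ^ 2 with hC₂
  set T : ℝ := M ^ 2 * C₂ / (2 * m) with hT
  set E4 : ℝ := ∫ g, quad (fun _ => 1) g ^ 2 ∂G with hE4
  have hE4N : (N : ℝ) ^ 2 ≤ E4 := by
    rw [hE4, integral_sq_quad_one_stdNormal]
    linarith [variance_nonneg (quad fun _ => (1 : ℝ)) (stdNormal N)]
  have hE4pos : 0 < E4 := lt_of_lt_of_le (by positivity) hE4N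
  have hσm : Measurable σ := measurable_rayleigh l
  have hσM : ∀ g, σ g ≤ M := fun g => by
    by_cases hg : g = 0
    · rw [hg, hσ, rayleigh_zero]; exact hM.le
    · exact (rayleigh_mem hml hlM hg).2
  have hσ0 : ∀ g, 0 ≤ σ g := rayleigh_nonneg hl
  have hτ0 : ∀ g, 0 ≤ τ g := fun g => by positivity
  have hτle : ∀ g, τ g ≤ (√m)⁻¹ ^ N := fun g => by
    by_cases hg : g = 0
    · simp only [hτ, hg, hσ, rayleigh_zero, Real.sqrt_zero, inv_zero, zero_pow hN]; positivity
    · exact pow_le_pow_left₀ (by positivity) (inv_anti₀ (Real.sqrt_pos.2 hm)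
        (Real.sqrt_le_sqrt (rayleigh_mem hml hlM hg).1)) N
  have hbdd : ∀ f : (Fin N → ℝ) → ℝ, Measurable f → ∀ D : ℝ, (∀ g, 0 ≤ f g) → (∀ g, f g ≤ D) →
      Integrable f G := fun f hf D h0 hD =>
    Integrable.of_bound hf.aestronglyMeasurable D (ae_of_all _ fun g => by
      rw [Real.norm_eq_abs, abs_of_nonneg (h0 g)]; exact hD g)
  have hτi : Integrable τ G := hbdd τ (by fun_prop) _ hτ0 hτle
  have hWi : Integrable W G := integrable_exp_of_bounded (by fun_prop) (exponent_le hl)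
  -- comparison of `quad l` with the squared length under `gaussianPi l`
  have hquad : ∀ g, quad l g = σ g * quad (fun _ => 1) g := fun g => by
    by_cases hg : g = 0
    · simp [hg, quad]
    · rw [hσ, rayleigh, div_mul_cancel₀ _ (quad_pos (fun _ => one_pos) hg).ne']
  have hcomp : ∀ F : (Fin N → ℝ) → ℝ, Measurable F → (∀ g, 0 ≤ F g) →
      (∀ t > (0 : ℝ), ∀ g, F (t • g) = F g) →
      Integrable (fun g => F g * quad (fun _ => 1) g ^ 2) (gaussianPi l) →
      κ * (∫ g, F g * τ g ∂G) * (N : ℝ) ^ 2 ≤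
        M ^ 2 * ∫ g, F g * quad (fun _ => 1) g ^ 2 ∂(gaussianPi l) := by
    intro F hF hF0 hFh hFi
    -- With the radial function `x ^ 2` the radial factor is `E4 ≥ N ^ 2`, and `quad l ≤ M * quad 1`
    -- replaces `quad l` by the squared length.
    have h := hfac F hF hF0 hFh (fun x => x ^ 2) (by fun_prop) fun x => sq_nonneg x
    calc κ * (∫ g, F g * τ g ∂G) * (N : ℝ) ^ 2 ≤ κ * (∫ g, F g * τ g ∂G) * E4 := by
          refine mul_le_mul_of_nonneg_left hE4N (mul_nonneg hκ.le ?_)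
          exact integral_nonneg fun g => mul_nonneg (hF0 g) (hτ0 g)
      _ = ∫ g, F g * quad l g ^ 2 ∂(gaussianPi l) := h.symm
      _ ≤ ∫ g, M ^ 2 * (F g * quad (fun _ => 1) g ^ 2) ∂(gaussianPi l) := by
          refine integral_mono_of_nonneg (ae_of_all _ fun g => mul_nonneg (hF0 g) (sq_nonneg _))
            (hFi.const_mul _) (ae_of_all _ fun g => ?_)
          simp only
          rw [hquad, mul_pow, mul_left_comm]
          refine mul_le_mul_of_nonneg_right ?_ (mul_nonneg (hF0 g) (sq_nonneg _))
          exact pow_le_pow_left₀ (hσ0 g) (hσM g) 2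
      _ = _ := integral_const_mul _ _
  have hτ1 : κ * ∫ g, τ g ∂G = 1 := by
    have h := hfac (fun _ => 1) measurable_const (fun _ => zero_le_one) (fun _ _ _ => rfl)
      (fun _ => 1) measurable_const fun _ => zero_le_one
    simpa [hτ] using h.symm
  -- the lower bound for the partition function
  have hvar : κ * (∫ g, (σ g - 1) ^ 2 * τ g ∂G) * N ≤ M ^ 2 * C₂ := by
    have hsq : ∀ g, (σ g - 1) ^ 2 * quad (fun _ => 1) g ^ 2 =
        (quad l g - quad (fun _ => 1) g) ^ 2 := fun g => by rw [hquad]; ring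
    have h := hcomp (fun g => (σ g - 1) ^ 2) (by fun_prop) (fun g => sq_nonneg _)
      (fun t ht g => by simp only [hσ, rayleigh_smul l ht]) (by
        simp only [hsq]
        exact ((memLp_quad_gaussianPi l l).sub (memLp_quad_gaussianPi l _)).integrable_sq)
    simp only [hsq] at h
    have h2 := h.trans (mul_le_mul_of_nonneg_left (integral_sq_quad_sub_le hm hml hsum)
      (sq_nonneg M))
    refine le_of_mul_le_mul_right ?_ hNr
    calc _ = κ * (∫ g, (σ g - 1) ^ 2 * τ g ∂G) * (N : ℝ) ^ 2 := by ring
      _ ≤ _ := h2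
      _ = _ := by rw [hC₂]; ring
  have hsqi : Integrable (fun g => (σ g - 1) ^ 2 * τ g) G := by
    refine hbdd _ (by fun_prop) ((M + 1) ^ 2 * (√m)⁻¹ ^ N)
      (fun g => mul_nonneg (sq_nonneg _) (hτ0 g)) fun g => ?_
    refine mul_le_mul ?_ (hτle g) (hτ0 g) (sq_nonneg _)
    exact sq_le_sq' (by linarith [hσ0 g]) (by linarith [hσM g])
  have hZ : Real.exp (-T) ≤ κ * ∫ g, W g ∂G := by
    have hpt : ∀ᵐ g ∂G, Real.exp (-T) * (1 + T) * τ g -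
        Real.exp (-T) * (N / (2 * m)) * ((σ g - 1) ^ 2 * τ g) ≤ W g := by
      filter_upwards [hne] with g hg
      refine le_trans ?_ (inv_sqrt_pow_mul_exp_le hm (rayleigh_mem hml hlM hg).1 N)
      -- Jensen's inequality by hand: `exp (-s) ≥ exp (-T) (1 + T - s)` is the tangent line at `T`,
      -- and `T` bounds the mean of `s = N (σ - 1)² / (2m)` under the probability density `κ τ`.
      have h1 := Real.add_one_le_exp (T - N * (σ g - 1) ^ 2 / (2 * m))
      have h2 : Real.exp (-(N * (σ g - 1) ^ 2 / (2 * m))) =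
          Real.exp (-T) * Real.exp (T - N * (σ g - 1) ^ 2 / (2 * m)) := by
        rw [← Real.exp_add]; congr 1; ring
      calc _ = τ g * (Real.exp (-T) * (T - N * (σ g - 1) ^ 2 / (2 * m) + 1)) := by ring
        _ ≤ τ g * (Real.exp (-T) * Real.exp (T - N * (σ g - 1) ^ 2 / (2 * m))) := by
            gcongr
        _ = _ := by rw [← h2]
    have h := integral_mono_ae ((hτi.const_mul _).sub (hsqi.const_mul _)) hWi hpt
    rw [integral_sub' (hτi.const_mul _) (hsqi.const_mul _), integral_const_mul,
      integral_const_mul] at h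
    have h3 := mul_le_mul_of_nonneg_left h hκ.le
    have h4 : (N / (2 * m)) * (κ * ∫ g, (σ g - 1) ^ 2 * τ g ∂G) ≤ T := by
      rw [hT, div_mul_eq_mul_div]
      exact div_le_div_of_nonneg_right (by linarith) (by positivity)
    have h5 := mul_le_mul_of_nonneg_left h4 (Real.exp_pos (-T)).le
    have h6 : κ * (Real.exp (-T) * (1 + T) * ∫ g, τ g ∂G) = Real.exp (-T) * (1 + T) := by
      rw [mul_left_comm, hτ1, mul_one]
    rw [mul_sub, h6] at h3
    linarith
  -- the upper bound for the numerator
  have hnum : κ * ∫ g, A g * W g ∂G ≤ M ^ 2 / (N : ℝ) ^ 2 *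
      ∫ g, A g * quad (fun _ => 1) g ^ 2 ∂(gaussianPi l) := by
    have hAτ : Integrable (fun g => A g * τ g) G :=
      hbdd _ (by fun_prop) (B * (√m)⁻¹ ^ N) (fun g => mul_nonneg (hA0 g) (hτ0 g)) fun g =>
        mul_le_mul (hAB g) (hτle g) (hτ0 g) ((hA0 g).trans (hAB g))
    have h1 : ∫ g, A g * W g ∂G ≤ ∫ g, A g * τ g ∂G := by
      refine integral_mono_of_nonneg
        (ae_of_all _ fun g => mul_nonneg (hA0 g) (Real.exp_pos _).le) hAτ ?_
      filter_upwards [hne] with g hg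
      exact mul_le_mul_of_nonneg_left
        (exp_le_inv_sqrt_pow (hm.trans_le (rayleigh_mem hml hlM hg).1) N) (hA0 g)
    refine (mul_le_mul_of_nonneg_left h1 hκ.le).trans ?_
    rw [div_mul_eq_mul_div, le_div_iff₀ (by positivity)]
    exact hcomp A hA hA0 hAh hAi
  have hZpos : 0 < κ * ∫ g, W g ∂G := (Real.exp_pos _).trans_le hZ
  rw [rayleighGibbs, integral_tilted_eq_div]
  change (∫ g, A g * W g ∂G) / ∫ g, W g ∂G ≤ _
  rw [← mul_div_mul_left _ _ hκ.ne', div_le_iff₀ hZpos]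
  have hI0 : 0 ≤ ∫ g, A g * quad (fun _ => 1) g ^ 2 ∂(gaussianPi l) :=
    integral_nonneg fun g => mul_nonneg (hA0 g) (sq_nonneg _)
  have hD : dominationConst m M = Real.exp T * M ^ 2 := rfl
  rw [hD]
  calc κ * ∫ g, A g * W g ∂G ≤ M ^ 2 / (N : ℝ) ^ 2 *
        ∫ g, A g * quad (fun _ => 1) g ^ 2 ∂(gaussianPi l) := hnum
    _ = Real.exp T * M ^ 2 / (N : ℝ) ^ 2 *
        (∫ g, A g * quad (fun _ => 1) g ^ 2 ∂(gaussianPi l)) * Real.exp (-T) := by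
        rw [Real.exp_neg]; field_simp
    _ ≤ _ := by
        refine mul_le_mul_of_nonneg_left hZ (mul_nonneg ?_ hI0)
        positivity

theorem dominationConst_nonneg : 0 ≤ dominationConst m M := by
  unfold dominationConst; positivity

theorem integral_sq_rayleigh_sub_one_le (hN : N ≠ 0) (hm : 0 < m) (hml : ∀ i, m ≤ l i)
    (hlM : ∀ i, l i ≤ M) (hsum : ∑ i, 1 / l i = N) :
    ∫ g, (rayleigh l g - 1) ^ 2 ∂(rayleighGibbs l) ≤
      dominationConst m M * (normalFourthMoment * (1 + 1 / m) ^ 2) / N := by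
  have hl : ∀ i, 0 < l i := fun i => hm.trans_le (hml i)
  have hNr : (0 : ℝ) < N := by exact_mod_cast Nat.pos_of_ne_zero hN
  have hM : 0 < M := (hl ⟨0, Nat.pos_of_ne_zero hN⟩).trans_le (hlM _)
  have hsq : ∀ g, (rayleigh l g - 1) ^ 2 * quad (fun _ => 1) g ^ 2 =
      (quad l g - quad (fun _ => 1) g) ^ 2 := fun g => by
    by_cases hg : g = 0
    · simp [hg, quad]
    · have := (quad_pos (fun _ => one_pos) hg).ne'
      rw [rayleigh]; field_simp
  have h := integral_rayleighGibbs_le hN hm hml hlM hsum (A := fun g => (rayleigh l g - 1) ^ 2)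
    (by fun_prop) (fun g => sq_nonneg _) (fun t ht g => by rw [rayleigh_smul l ht])
    (B := (M + 1) ^ 2) (fun g => by
      have h0 := rayleigh_nonneg hl g
      have hle : rayleigh l g ≤ M := by
        by_cases hg : g = 0
        · rw [hg, rayleigh_zero]; exact hM.le
        · exact (rayleigh_mem hml hlM hg).2
      exact sq_le_sq' (by linarith) (by linarith))
    (by
      simp only [hsq]
      exact ((memLp_quad_gaussianPi l l).sub (memLp_quad_gaussianPi l _)).integrable_sq)
  simp only [hsq] at h
  refine h.trans ((mul_le_mul_of_nonneg_left (integral_sq_quad_sub_le hm hml hsum)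
    (div_nonneg dominationConst_nonneg (sq_nonneg _))).trans_eq ?_)
  field_simp

theorem integral_sq_quad_one_sub_rayleighGibbs_le (hN : N ≠ 0) (hl : ∀ i, 0 < l i) :
    ∫ g, (quad (fun _ => 1) g - N) ^ 2 ∂(rayleighGibbs l) ≤ normalFourthMoment * N := by
  have := isProbabilityMeasure_rayleighGibbs hl
  have h := integral_mul_comp_quad_rayleighGibbs hN l (A := fun _ => 1) measurable_const
    (fun _ => zero_le_one) (fun _ _ _ => rfl) (ψ := fun x => (x - N) ^ 2) (by fun_prop)
    fun x => sq_nonneg _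
  simp only [one_mul, integral_const, probReal_univ, smul_eq_mul] at h
  rw [h]
  have h2 := variance_eq_integral (X := quad fun _ => (1 : ℝ)) (μ := stdNormal N) (by fun_prop)
  rw [integral_quad_one_stdNormal] at h2
  rw [← h2]
  exact variance_quad_one_stdNormal_le

/-- Write `g i ^ 4` as the angular function `g i ^ 4 / ‖g‖ ^ 4` times `‖g‖ ^ 4`; the factors are
independent under the Gibbs weight. Domination gives order `N ^ (-2)` for the first, and the
standard normal law gives order `N ^ 2` for the second. -/
theorem integral_pow_four_rayleighGibbs_le (hN : N ≠ 0) (hm : 0 < m) (hml : ∀ i, m ≤ l i)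
    (hlM : ∀ i, l i ≤ M) (hsum : ∑ i, 1 / l i = N) (i : Fin N) :
    ∫ g, g i ^ 4 ∂(rayleighGibbs l) ≤
      dominationConst m M * (normalFourthMoment / m ^ 2) * (normalFourthMoment + 1) := by
  have hl : ∀ i, 0 < l i := fun i => hm.trans_le (hml i)
  have hN1 : (1 : ℝ) ≤ N := by exact_mod_cast Nat.one_le_iff_ne_zero.2 hN
  have hNr : (0 : ℝ) < N := by linarith
  set A : (Fin N → ℝ) → ℝ := fun g => g i ^ 4 / quad (fun _ => 1) g ^ 2 with hA
  have hAm : Measurable A := by fun_prop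
  have hA0 : ∀ g, 0 ≤ A g := fun g => by positivity
  have hAh : ∀ t > (0 : ℝ), ∀ g, A (t • g) = A g := fun t ht g => by
    simp only [hA, quad_smul, Pi.smul_apply, smul_eq_mul]
    rw [mul_pow, mul_pow, ← pow_mul, mul_div_mul_left _ _ (by positivity)]
  have hi : ∀ g : Fin N → ℝ, g i ^ 2 ≤ quad (fun _ => 1) g := fun g => by
    simp only [quad, one_mul]
    exact Finset.single_le_sum (f := fun j => g j ^ 2) (fun j _ => sq_nonneg _) (Finset.mem_univ i)
  have hAq : ∀ g, A g * quad (fun _ => 1) g ^ 2 = g i ^ 4 := fun g => by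
    by_cases hg : g = 0
    · simp [hg, quad]
    · simp only [hA]
      rw [div_mul_cancel₀ _ (pow_ne_zero 2 (quad_pos (fun _ => one_pos) hg).ne')]
  have hAB : ∀ g, A g ≤ 1 := fun g => by
    refine div_le_one_of_le₀ ?_ (sq_nonneg _)
    rw [show g i ^ 4 = (g i ^ 2) ^ 2 by ring]
    exact pow_le_pow_left₀ (sq_nonneg _) (hi g) 2
  have h1 := integral_rayleighGibbs_le hN hm hml hlM hsum hAm hA0 hAh hAB
    (by simp only [hAq]; exact integrable_pow_four_gaussianPi l i)
  have h2 := integral_mul_comp_quad_rayleighGibbs hN l hAm hA0 hAh (ψ := fun x => x ^ 2)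
    (by fun_prop) fun x => sq_nonneg x
  simp only [hAq, integral_pow_four_gaussianPi hl] at h1 h2
  rw [h2, integral_sq_quad_one_stdNormal]
  have h3 : Var[quad (fun _ => 1); stdNormal N] + (N : ℝ) ^ 2 ≤
      (normalFourthMoment + 1) * (N : ℝ) ^ 2 := by
    have := variance_quad_one_stdNormal_le (N := N)
    have h5 : normalFourthMoment * (N : ℝ) ≤ normalFourthMoment * (N : ℝ) ^ 2 :=
      mul_le_mul_of_nonneg_left (by nlinarith) normalFourthMoment_nonneg
    linarith
  have h4 : normalFourthMoment / l i ^ 2 ≤ normalFourthMoment / m ^ 2 :=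
    div_le_div_of_nonneg_left normalFourthMoment_nonneg (by positivity)
      (pow_le_pow_left₀ hm.le (hml i) 2)
  have hc := dominationConst_nonneg (m := m) (M := M)
  have hv := variance_nonneg (quad fun _ => (1 : ℝ)) (stdNormal N)
  have hn := normalFourthMoment_nonneg
  calc (∫ g, A g ∂(rayleighGibbs l)) * (Var[quad (fun _ => 1); stdNormal N] + (N : ℝ) ^ 2)
      ≤ (dominationConst m M / (N : ℝ) ^ 2 * (normalFourthMoment / m ^ 2)) *
          ((normalFourthMoment + 1) * (N : ℝ) ^ 2) := by
        refine mul_le_mul (h1.trans ?_) h3 (by positivity) (by positivity)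
        gcongr
    _ = _ := by field_simp

end Domination

/-! ### Tilted measures and measure preserving involutions -/

theorem abs_exp_sub_exp_le (x y : ℝ) :
    |Real.exp x - Real.exp y| ≤ min 1 |x - y| * (Real.exp x + Real.exp y) := by
  wlog h : y ≤ x generalizing x y
  · rw [abs_sub_comm, abs_sub_comm x y, add_comm]
    exact this y x (not_le.1 h).le
  have hx := Real.exp_pos x
  have hy := Real.exp_pos y
  rw [abs_of_nonneg (sub_nonneg.2 (Real.exp_le_exp.2 h)), abs_of_nonneg (sub_nonneg.2 h)]
  rcases min_choice 1 (x - y) with hc | hc <;> rw [hc]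
  · linarith
  · have h1 := Real.add_one_le_exp (y - x)
    have h2 : Real.exp y = Real.exp x * Real.exp (y - x) := by
      rw [← Real.exp_add]; congr 1; ring
    have h3 := mul_le_mul_of_nonneg_left h1 hx.le
    have h4 := mul_nonneg (sub_nonneg.2 h) hy.le
    nlinarith

/-- Invariance of `μ` moves `T` from `f` to the weight, leaving `exp u - exp (u ∘ T)` to be
integrated. The truncated difference `min 1 |u - u ∘ T|` is itself `T`-invariant, so both weights
contribute equally; this is the factor `2`. -/
theorem abs_integral_tilted_sub_comp_le {Ω : Type*} {mΩ : MeasurableSpace Ω} {μ : Measure Ω}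
    [IsProbabilityMeasure μ] {T : Ω → Ω} (hT : MeasurePreserving T μ μ)
    (hTT : Function.Involutive T) {u : Ω → ℝ} (hu : Measurable u)
    (hui : Integrable (fun x => Real.exp (u x)) μ) {f : Ω → ℝ} (hf : Measurable f) {C : ℝ}
    (hC : ∀ x, |f x| ≤ C) :
    |∫ x, f x ∂(μ.tilted u) - ∫ x, f (T x) ∂(μ.tilted u)| ≤
      2 * C * ∫ x, min 1 |u x - u (T x)| ∂(μ.tilted u) := by
  have hTm := hT.measurable
  have hcomp : ∀ F : Ω → ℝ, Measurable F → ∫ x, F (T x) ∂μ = ∫ x, F x ∂μ := fun F hF => by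
    conv_rhs => rw [← hT.map_eq]
    rw [integral_map hTm.aemeasurable hF.aestronglyMeasurable]
  have hZ : 0 < ∫ x, Real.exp (u x) ∂μ := integral_exp_pos hui
  have huiT : Integrable (fun x => Real.exp (u (T x))) μ := hT.integrable_comp_of_integrable hui
  have hC0 : 0 ≤ C := by
    have : Nonempty Ω := (inferInstance : NeZero μ).out |> fun h => by
      by_contra hne
      rw [not_nonempty_iff] at hne
      exact h (Measure.eq_zero_of_isEmpty μ)
    obtain ⟨x⟩ := this
    exact (abs_nonneg _).trans (hC x)
  have hfi : ∀ {w : Ω → ℝ}, Integrable w μ → Integrable (fun x => f x * w x) μ := fun hw =>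
    hw.bdd_mul (c := C) hf.aestronglyMeasurable (ae_of_all _ hC)
  set δ : Ω → ℝ := fun x => min 1 |u x - u (T x)| with hδ
  have hδm : Measurable δ := measurable_const.min ((hu.sub (hu.comp hTm)).abs)
  have hδi : ∀ {w : Ω → ℝ}, Integrable w μ → Integrable (fun x => δ x * w x) μ := fun hw =>
    hw.bdd_mul (c := 1) hδm.aestronglyMeasurable (ae_of_all _ fun x => by
      rw [Real.norm_eq_abs, abs_of_nonneg (le_min zero_le_one (abs_nonneg _))]
      exact min_le_left _ _)
  have e1 : ∫ x, f (T x) * Real.exp (u x) ∂μ = ∫ x, f x * Real.exp (u (T x)) ∂μ := by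
    rw [← hcomp (fun x => f (T x) * Real.exp (u x)) (by fun_prop)]
    simp only [hTT _]
  have e2 : ∫ x, δ x * Real.exp (u (T x)) ∂μ = ∫ x, δ x * Real.exp (u x) ∂μ := by
    rw [← hcomp (fun x => δ x * Real.exp (u x)) (by fun_prop)]
    refine integral_congr_ae (ae_of_all _ fun x => ?_)
    simp only [hδ, hTT x, abs_sub_comm]
  rw [integral_tilted_eq_div, integral_tilted_eq_div, integral_tilted_eq_div, e1, ← sub_div,
    abs_div, abs_of_pos hZ, ← mul_div_assoc]
  refine div_le_div_of_nonneg_right ?_ hZ.le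
  rw [← integral_sub (hfi hui) (hfi huiT)]
  calc |∫ x, (f x * Real.exp (u x) - f x * Real.exp (u (T x))) ∂μ|
      ≤ ∫ x, |f x * Real.exp (u x) - f x * Real.exp (u (T x))| ∂μ := abs_integral_le_integral_abs
    _ ≤ ∫ x, C * (δ x * Real.exp (u x) + δ x * Real.exp (u (T x))) ∂μ := by
        refine integral_mono ((hfi hui).sub (hfi huiT)).abs
          (((hδi hui).add (hδi huiT)).const_mul C) fun x => ?_
        simp only
        rw [← mul_sub, abs_mul, ← mul_add]
        exact mul_le_mul (hC x) (abs_exp_sub_exp_le _ _) (abs_nonneg _) hC0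
    _ = 2 * C * ∫ x, δ x * Real.exp (u x) ∂μ := by
        rw [integral_const_mul, integral_add (hδi hui) (hδi huiT), e2]; ring

theorem prod_tilted {α β : Type*} {mα : MeasurableSpace α} {mβ : MeasurableSpace β}
    {μ : Measure α} {ν : Measure β} [SigmaFinite μ] [SigmaFinite ν] {u : α → ℝ} {w : β → ℝ}
    (hu : Measurable u) (hw : Measurable w) :
    (μ.tilted u).prod (ν.tilted w) = (μ.prod ν).tilted fun p => u p.1 + w p.2 := by
  unfold Measure.tilted
  rw [prod_withDensity (by fun_prop) (by fun_prop)]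
  congr 1
  funext p
  have e : ∫ p : α × β, Real.exp (u p.1 + w p.2) ∂(μ.prod ν) =
      (∫ x, Real.exp (u x) ∂μ) * ∫ y, Real.exp (w y) ∂ν := by
    simp only [Real.exp_add]
    exact integral_prod_mul (fun x => Real.exp (u x)) fun y => Real.exp (w y)
  rw [← ENNReal.ofReal_mul (div_nonneg (Real.exp_pos _).le
    (integral_nonneg fun _ => (Real.exp_pos _).le)), e, Real.exp_add, div_mul_div_comm]

/-- A product of centred Gaussians is a quadratic tilt of the standard normal measure. -/
theorem gaussianPi_eq_tilted {k : ℕ} {l : Fin k → ℝ} (hl : ∀ i, 0 < l i) :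
    Integrable (fun x => Real.exp (quad (fun i => (1 - l i) / 2) x)) (stdNormal k) ∧
      gaussianPi l = (stdNormal k).tilted (quad fun i => (1 - l i) / 2) := by
  obtain ⟨C, hC, hCe⟩ := exists_gaussianPi_eq_withDensity hl
  obtain ⟨D, hD, hDe⟩ := exists_gaussianPi_eq_withDensity (ι := Fin k) (l := fun _ => 1)
    fun _ => one_pos
  rw [← stdNormal_eq_gaussianPi] at hDe
  set w : (Fin k → ℝ) → ℝ := quad fun i => (1 - l i) / 2 with hw
  have hwm : Measurable w := measurable_quad _
  have hquad : ∀ g, -(quad l g) / 2 = -(quad (fun _ => 1) g) / 2 + w g := fun g => by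
    simp only [hw, quad, neg_div, Finset.sum_div]
    rw [← sub_eq_zero, ← Finset.sum_neg_distrib, ← Finset.sum_neg_distrib,
      ← Finset.sum_add_distrib, ← Finset.sum_sub_distrib]
    exact Finset.sum_eq_zero fun i _ => by ring
  have he : gaussianPi l = (stdNormal k).withDensity fun x =>
      ENNReal.ofReal (C / D * Real.exp (w x)) := by
    rw [hDe, ← withDensity_mul _ (by fun_prop) (by fun_prop), hCe]
    congr 1
    funext g
    rw [Pi.mul_apply, ← ENNReal.ofReal_mul (by positivity), hquad, Real.exp_add]
    congr 1
    field_simp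
  have hCD : 0 < C / D := div_pos hC hD
  -- The tilt may be unbounded above, so integrability of `exp w` and the normalizing constant are
  -- both read off from the total mass of `gaussianPi l`.
  have hlint : ∫⁻ x, ENNReal.ofReal (C / D * Real.exp (w x)) ∂(stdNormal k) = 1 := by
    have : gaussianPi l univ = 1 := measure_univ
    rwa [he, withDensity_apply _ MeasurableSet.univ, Measure.restrict_univ] at this
  have hint : Integrable (fun x => C / D * Real.exp (w x)) (stdNormal k) := by
    refine ⟨by fun_prop, ?_⟩
    rw [hasFiniteIntegral_iff_ofReal (ae_of_all _ fun x => by positivity), hlint]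
    exact ENNReal.one_lt_top
  have hval : C / D * ∫ x, Real.exp (w x) ∂(stdNormal k) = 1 := by
    rw [← integral_const_mul, integral_eq_lintegral_of_nonneg_ae
      (ae_of_all _ fun x => by positivity) (by fun_prop), hlint, ENNReal.toReal_one]
  refine ⟨(integrable_const_mul_iff (IsUnit.mk0 _ hCD.ne') _).1 hint, ?_⟩
  rw [he, Measure.tilted]
  congr 1
  funext x
  congr 1
  rw [eq_div_iff (right_ne_zero_of_mul_eq_one hval), mul_right_comm, hval, one_mul]

/-! ### Exchanging finitely many coordinates with an independent copy -/

section Swap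

variable {N k : ℕ} {d : Fin k → Fin N}

open Classical in
/-- The permutation of the disjoint union of the index sets that exchanges `d i` and `i`. -/
noncomputable def swapFun (d : Fin k → Fin N) : Fin N ⊕ Fin k → Fin N ⊕ Fin k :=
  Sum.elim (fun j => if h : ∃ i, d i = j then Sum.inr h.choose else Sum.inl j)
    fun i => Sum.inl (d i)

theorem swapFun_apply_index (hd : Function.Injective d) (i : Fin k) :
    swapFun d (Sum.inl (d i)) = Sum.inr i := by
  have h : ∃ i', d i' = d i := ⟨i, rfl⟩
  simp only [swapFun, Sum.elim_inl, dif_pos h]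
  rw [hd h.choose_spec]

theorem swapFun_involutive (hd : Function.Injective d) : Function.Involutive (swapFun d) := by
  rintro (j | i)
  · by_cases h : ∃ i, d i = j
    · obtain ⟨i, rfl⟩ := h
      rw [swapFun_apply_index hd]; rfl
    · have : swapFun d (Sum.inl j) = Sum.inl j := by simp only [swapFun, Sum.elim_inl, dif_neg h]
      rw [this, this]
  · exact swapFun_apply_index hd i

/-- The map that exchanges the coordinates `g (d i)` of the first vector with the second vector. -/
noncomputable def swapMap (d : Fin k → Fin N) (p : (Fin N → ℝ) × (Fin k → ℝ)) :
    (Fin N → ℝ) × (Fin k → ℝ) :=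
  (fun j => Sum.elim p.1 p.2 (swapFun d (Sum.inl j)), fun i => p.1 (d i))

theorem elim_swapMap (p : (Fin N → ℝ) × (Fin k → ℝ)) (s : Fin N ⊕ Fin k) :
    Sum.elim (swapMap d p).1 (swapMap d p).2 s = Sum.elim p.1 p.2 (swapFun d s) := by
  rcases s with j | i <;> rfl

theorem swapMap_involutive (hd : Function.Injective d) : Function.Involutive (swapMap d) := by
  intro p
  refine Prod.ext (funext fun j => ?_) (funext fun i => ?_)
  · change Sum.elim (swapMap d p).1 (swapMap d p).2 (swapFun d (Sum.inl j)) = p.1 j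
    rw [elim_swapMap, swapFun_involutive hd]; rfl
  · change Sum.elim p.1 p.2 (swapFun d (Sum.inl (d i))) = p.2 i
    rw [swapFun_apply_index hd]; rfl

/-- Both sides are one sum over the disjoint union of the index sets, reindexed by the swap. The
incoming coordinate `i` carries the coefficient `a (d i)`, so the coefficients are invariant. -/
theorem quad_swapMap (hd : Function.Injective d) (a : Fin N → ℝ)
    (p : (Fin N → ℝ) × (Fin k → ℝ)) :
    quad a (swapMap d p).1 + quad (fun i => a (d i)) (fun i => p.1 (d i)) =
      quad a p.1 + quad (fun i => a (d i)) p.2 := by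
  have hinv : ∀ s, Sum.elim a (fun i => a (d i)) (swapFun d s) =
      Sum.elim a (fun i => a (d i)) s := by
    rintro (j | i)
    · by_cases h : ∃ i, d i = j
      · obtain ⟨i, rfl⟩ := h
        rw [swapFun_apply_index hd]; rfl
      · simp only [swapFun, Sum.elim_inl, dif_neg h]
    · rfl
  have h := Equiv.sum_comp (swapFun_involutive hd).toPerm
    fun s => Sum.elim a (fun i => a (d i)) s * Sum.elim p.1 p.2 s ^ 2
  simp only [Function.Involutive.coe_toPerm, hinv, ← elim_swapMap, Fintype.sum_sum_type,
    Sum.elim_inl, Sum.elim_inr] at h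
  exact h

theorem measurePreserving_swapMap (hd : Function.Injective d) :
    MeasurePreserving (swapMap d) ((stdNormal N).prod (stdNormal k))
      ((stdNormal N).prod (stdNormal k)) := by
  have h1 := measurePreserving_sumPiEquivProdPi (X := fun _ : Fin N ⊕ Fin k => ℝ)
    fun _ => gaussianReal 0 1
  have h2 := measurePreserving_piCongrLeft (α := fun _ : Fin N ⊕ Fin k => ℝ)
    (fun _ => gaussianReal 0 1) (swapFun_involutive hd).toPerm
  have h3 := (h1.comp h2).comp (h1.symm _)
  have hpt : ∀ (ω : Fin N ⊕ Fin k → ℝ) (s : Fin N ⊕ Fin k),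
      MeasurableEquiv.piCongrLeft (fun _ : Fin N ⊕ Fin k => ℝ) (swapFun_involutive hd).toPerm ω s =
        ω (swapFun d s) := by
    intro ω s
    obtain ⟨t, rfl⟩ := (swapFun_involutive hd).toPerm.surjective s
    rw [MeasurableEquiv.coe_piCongrLeft, Equiv.piCongrLeft_apply_apply,
      Function.Involutive.coe_toPerm, swapFun_involutive hd]
  have he : swapMap d = (MeasurableEquiv.sumPiEquivProdPi fun _ : Fin N ⊕ Fin k => ℝ) ∘
      (MeasurableEquiv.piCongrLeft (fun _ : Fin N ⊕ Fin k => ℝ)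
        (swapFun_involutive hd).toPerm) ∘
      (MeasurableEquiv.sumPiEquivProdPi fun _ : Fin N ⊕ Fin k => ℝ).symm := by
    funext p
    have hsym : ∀ s, (MeasurableEquiv.sumPiEquivProdPi fun _ : Fin N ⊕ Fin k => ℝ).symm p s =
        Sum.elim p.1 p.2 s := by
      rintro (j | i) <;> rfl
    refine Prod.ext (funext fun j => ?_) (funext fun i => ?_)
    · exact ((hpt _ (Sum.inl j)).trans (hsym _)).symm
    · exact ((hpt _ (Sum.inr i)).trans (hsym _)).symm
  rw [he]
  exact h3

end Swap

/-! ### The exchange estimate -/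

theorem two_mul_le_add_div {x y t : ℝ} (ht : 0 < t) : 2 * (x * y) ≤ t * y ^ 2 + x ^ 2 / t := by
  have h : 0 ≤ (t * y - x) ^ 2 / t := by positivity
  have e : (t * y - x) ^ 2 / t = t * y ^ 2 + x ^ 2 / t - 2 * (x * y) := by
    field_simp; ring
  linarith

/-- The effect on the exponent of exchanging some coordinates: `R` and `E` are the squared length
and the energy before the exchange, `R'` and `E'` after it. -/
theorem min_one_abs_exchange_le {n R R' E E' h h' ξ ξ' a a' b v θ t : ℝ} (hn : 1 ≤ n) (ht : 0 < t)
    (hnt : 1 / n ≤ t ^ 2) (hb : 0 ≤ b) (hξ : 0 ≤ ξ) (hξ' : 0 ≤ ξ')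
    (hE : E = h * R) (hh' : h' = E' / R') (hR' : R' = R + ξ' - ξ) (hE' : E' = E + a' - a)
    (hab : |h * (ξ' - ξ) - (a' - a)| ≤ b * (ξ + ξ')) :
    min 1 |θ * (n * h + (a' - v * ξ')) - θ * (n * h' + (a - v * ξ))| ≤
      (2 + |θ| * (3 * b + 1)) *
        (t * (1 + (ξ + ξ') ^ 2) + (R - n) ^ 2 / n ^ 2 / t + (h - v) ^ 2 / t) := by
  have hn0 : 0 < n := by linarith
  set s := ξ + ξ' with hs
  have hs0 : 0 ≤ s := by positivity
  set e := 2 * (|R - n| + s) / n with he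
  have he0 : 0 ≤ e := by positivity
  have hnt' : 1 / n ≤ t := by
    have h1 : (1 / n) ^ 2 ≤ t ^ 2 := by
      refine le_trans ?_ hnt
      have : 1 / n ≤ 1 := by rw [div_le_one hn0]; exact hn
      have h0 : 0 ≤ 1 / n := by positivity
      nlinarith
    exact le_of_sq_le_sq h1 ht.le
  have habs : |R' - n| ≤ |R - n| + s := by
    have : R' - n = (R - n) + (ξ' - ξ) := by rw [hR']; ring
    rw [this]
    refine (abs_add_le _ _).trans ?_
    have : |ξ' - ξ| ≤ s := abs_le.2 ⟨by linarith, by linarith⟩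
    linarith
  -- the bound before using `t`
  have hmain : min 1 |θ * (n * h + (a' - v * ξ')) - θ * (n * h' + (a - v * ξ))| ≤
      e + |θ| * (e * (b * s) + |h - v| * s) := by
    have hpos : 0 ≤ |θ| * (e * (b * s) + |h - v| * s) := by positivity
    -- If the new squared length is far below `n`, then `e ≥ 1` and the truncation at `1` suffices.
    -- Otherwise `R' ≥ n / 2` makes division by `R'` safe.
    rcases lt_or_ge R' (n / 2) with hlt | hge
    · refine (min_le_left _ _).trans ?_
      have h1 : n / 2 ≤ |R - n| + s := by
        refine le_trans ?_ habs
        rw [abs_of_neg (by linarith)]; linarith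
      have h2 : 1 ≤ e := by
        rw [he, le_div_iff₀ hn0]; linarith
      linarith
    · refine (min_le_right _ _).trans ?_
      have hR0 : 0 < R' := by linarith
      -- The decisive cancellation: what remains are products of a small factor, `n / R' - 1` or `h
      -- - v`, with quantities linear in the exchanged blocks.
      have e1 : θ * (n * h + (a' - v * ξ')) - θ * (n * h' + (a - v * ξ)) =
          θ * ((n / R' - 1) * (h * (ξ' - ξ) - (a' - a)) + (h - v) * (ξ' - ξ)) := by
        have e2 : n * h' = n * h - n / R' * (h * (ξ' - ξ) - (a' - a)) := by
          rw [hh', hE', hE]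
          field_simp
          rw [hR']
          ring
        rw [e2]
        ring
      have h3 : |n / R' - 1| ≤ e := by
        have : n / R' - 1 = (n - R') / R' := by field_simp
        rw [this, abs_div, abs_of_pos hR0, abs_sub_comm, he]
        calc |R' - n| / R' ≤ (|R - n| + s) / (n / 2) := by gcongr
          _ = _ := by field_simp
      have h4 : |ξ' - ξ| ≤ s := abs_le.2 ⟨by linarith, by linarith⟩
      rw [e1, abs_mul]
      have h5 : |(n / R' - 1) * (h * (ξ' - ξ) - (a' - a)) + (h - v) * (ξ' - ξ)| ≤
          e * (b * s) + |h - v| * s := by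
        refine (abs_add_le _ _).trans ?_
        rw [abs_mul, abs_mul]
        gcongr
      have h6 := mul_le_mul_of_nonneg_left h5 (abs_nonneg θ)
      linarith
  refine hmain.trans ?_
  -- Each product is split by the weighted inequality `2xy ≤ t y² + x² / t`, so that only second
  -- moments of `R - n`, `h - v` and `s` remain. With `t ≥ n ^ (-1/2)` and second moments of `h - v`
  -- below `t²`, every term is of order `t` in mean.
  set X := t * (1 + s ^ 2) with hX
  set Y := (R - n) ^ 2 / n ^ 2 / t with hY
  set V := (h - v) ^ 2 / t with hV
  have hX0 : 0 ≤ X := by positivity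
  have hY0 : 0 ≤ Y := by positivity
  have hV0 : 0 ≤ V := by positivity
  have hYe : (|R - n| / n) ^ 2 / t = Y := by rw [div_pow, sq_abs]
  have hse : e = 2 * (|R - n| / n) + 2 * s * (1 / n) := by rw [he]; field_simp
  have k1 : e ≤ 2 * X + Y := by
    have := two_mul_le_add_div (x := |R - n| / n) (y := 1) ht
    rw [hYe] at this
    have h2 : 2 * s * (1 / n) ≤ (1 + s ^ 2) * t :=
      mul_le_mul (by nlinarith [sq_nonneg (s - 1)]) hnt' (by positivity) (by positivity)
    have h3 : t ≤ X := by rw [hX]; nlinarith [mul_nonneg ht.le (sq_nonneg s)]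
    rw [hse]
    linarith
  have hts : t * s ^ 2 ≤ X := by rw [hX]; linarith
  have k2 : e * s ≤ 3 * X + Y := by
    have := two_mul_le_add_div (x := |R - n| / n) (y := s) ht
    rw [hYe] at this
    have h2 : 2 * s * (1 / n) * s ≤ 2 * (t * s ^ 2) := by
      have := mul_le_mul_of_nonneg_left hnt' (show 0 ≤ 2 * s * s by positivity)
      linarith
    rw [hse, add_mul]
    linarith
  have k3 : |h - v| * s ≤ X + V := by
    have := two_mul_le_add_div (x := |h - v|) (y := s) ht
    rw [sq_abs] at this
    linarith
  have k4 : e * (b * s) ≤ b * (3 * X + Y) := by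
    have := mul_le_mul_of_nonneg_left k2 hb
    linarith
  have k5 : e * (b * s) + |h - v| * s ≤ (3 * b + 1) * (X + Y + V) := by
    have h1 := mul_nonneg hb hY0
    have h2 := mul_nonneg hb hV0
    have h3 : (3 * b + 1) * (X + Y + V) =
      b * (3 * X + Y) + (X + V) + (2 * (b * Y) + 3 * (b * V) + Y) := by ring
    rw [h3]
    linarith
  have k6 := mul_le_mul_of_nonneg_left k5 (abs_nonneg θ)
  calc e + |θ| * (e * (b * s) + |h - v| * s)
      ≤ 2 * (X + Y + V) + |θ| * ((3 * b + 1) * (X + Y + V)) := by linarith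
    _ = _ := by ring

theorem hamiltonian_eq {N : ℕ} (c g : Fin N → ℝ) : hamiltonian c g = N * rayleigh c g := by
  simp only [hamiltonian, rayleigh, quad, one_mul, Finset.sum_div, mul_div_assoc]

theorem energy_eq {N : ℕ} (hN : N ≠ 0) (c g : Fin N → ℝ) : energy c g = rayleigh c g := by
  have : (N : ℝ) ≠ 0 := by exact_mod_cast hN
  rw [energy, hamiltonian_eq, mul_div_cancel_left₀ _ this]

/-- The Gibbs measure. -/
noncomputable def gibbs {N : ℕ} (c : Fin N → ℝ) (θ : ℝ) : Measure (Fin N → ℝ) :=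
  (stdNormal N).tilted fun g => θ * hamiltonian c g

theorem gibbsMean_eq {N : ℕ} (c : Fin N → ℝ) (θ : ℝ) (f : (Fin N → ℝ) → ℝ) :
    gibbsMean c θ f = ∫ g, f g ∂(gibbs c θ) := by
  rw [gibbs, integral_tilted_eq_div, gibbsMean, partitionFunction, one_div, inv_mul_eq_div]

theorem rayleigh_mem_Icc {N : ℕ} {c : Fin N → ℝ} {b : ℝ} (hb : 0 ≤ b) (hc : ∀ i, c i ∈ Icc 0 b)
    (g : Fin N → ℝ) : rayleigh c g ∈ Icc 0 b := by
  by_cases hg : g = 0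
  · rw [hg, rayleigh_zero]; exact ⟨le_rfl, hb⟩
  · exact rayleigh_mem (fun i => (hc i).1) (fun i => (hc i).2) hg

@[fun_prop]
theorem measurable_hamiltonian {N : ℕ} (c : Fin N → ℝ) : Measurable (hamiltonian c) := by
  have : hamiltonian c = fun g => N * rayleigh c g := funext (hamiltonian_eq c)
  rw [this]; fun_prop

theorem mul_hamiltonian_le {N : ℕ} {c : Fin N → ℝ} {b : ℝ} (hb : 0 ≤ b) (hc : ∀ i, c i ∈ Icc 0 b)
    (θ : ℝ) (g : Fin N → ℝ) : θ * hamiltonian c g ≤ |θ| * (N * b) := by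
  rw [hamiltonian_eq]
  have h := rayleigh_mem_Icc hb hc g
  have hN : (0 : ℝ) ≤ N := Nat.cast_nonneg N
  exact mul_le_mul (le_abs_self θ) (mul_le_mul_of_nonneg_left h.2 hN)
    (mul_nonneg hN h.1) (abs_nonneg θ)

theorem isProbabilityMeasure_gibbs {N : ℕ} {c : Fin N → ℝ} {b : ℝ} (hb : 0 ≤ b)
    (hc : ∀ i, c i ∈ Icc 0 b) (θ : ℝ) : IsProbabilityMeasure (gibbs c θ) :=
  isProbabilityMeasure_tilted
    (integrable_exp_of_bounded (by fun_prop) (mul_hamiltonian_le hb hc θ))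

theorem integrable_gibbs {N : ℕ} {c : Fin N → ℝ} {b : ℝ} (hb : 0 ≤ b) (hc : ∀ i, c i ∈ Icc 0 b)
    (θ : ℝ) {f : (Fin N → ℝ) → ℝ} (hf : Integrable f (stdNormal N)) : Integrable f (gibbs c θ) :=
  integrable_tilted_of_bounded (by fun_prop) (mul_hamiltonian_le hb hc θ) hf

theorem sq_quad_one_le {k : ℕ} (x : Fin k → ℝ) :
    quad (fun _ => 1) x ^ 2 ≤ k * ∑ i, x i ^ 4 := by
  have h := sq_sum_le_card_mul_sum_sq (s := Finset.univ) (f := fun i => x i ^ 2)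
  simpa [quad, ← pow_mul] using h

/-- The law of finitely many coordinates under the Gibbs measure is close to a product of Gaussians
in total variation, given second moment bounds. -/
theorem abs_integral_gibbs_sub_le {N k : ℕ} (hN : N ≠ 0) {c : Fin N → ℝ} {b : ℝ} (hb : 0 ≤ b)
    (hc : ∀ i, c i ∈ Icc 0 b) {θ v t : ℝ} (ht : 0 < t) (hNt : 1 / (N : ℝ) ≤ t ^ 2)
    {d : Fin k → Fin N} (hd : Function.Injective d) (hl : ∀ i, 0 < 1 + 2 * θ * (v - c (d i)))
    {C D : ℝ} (hC : ∀ i, ∫ g, g i ^ 4 ∂(gibbs c θ) ≤ C)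
    (hC' : ∀ i, normalFourthMoment / (1 + 2 * θ * (v - c (d i))) ^ 2 ≤ C)
    (hD : ∫ g, (quad (fun _ => 1) g - N) ^ 2 ∂(gibbs c θ) ≤ D * N)
    (hv : ∫ g, (rayleigh c g - v) ^ 2 ∂(gibbs c θ) ≤ t ^ 2)
    {f : (Fin k → ℝ) → ℝ} (hf : Measurable f) {B : ℝ} (hB : ∀ x, |f x| ≤ B) :
    |∫ g, f (fun i => g (d i)) ∂(gibbs c θ) -
        ∫ x, f x ∂(gaussianPi fun i => 1 + 2 * θ * (v - c (d i)))| ≤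
      2 * B * ((2 + |θ| * (3 * b + 1)) * (2 + 4 * k ^ 2 * C + D)) * t := by
  have hNr : (1 : ℝ) ≤ N := by exact_mod_cast Nat.one_le_iff_ne_zero.2 hN
  set l : Fin k → ℝ := fun i => 1 + 2 * θ * (v - c (d i)) with hldef
  have hPp := isProbabilityMeasure_gibbs hb hc θ
  obtain ⟨hwi, hq⟩ := gaussianPi_eq_tilted hl
  -- The variances of the limit law are chosen so that its tilt is `θ` times block energy minus `v`
  -- times squared length, which is the form `min_one_abs_exchange_le` requires.
  have hwe : ∀ x, quad (fun i => (1 - l i) / 2) x =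
      θ * (quad (fun i => c (d i)) x - v * quad (fun _ => 1) x) := fun x => by
    simp only [quad, Finset.mul_sum, ← Finset.sum_sub_distrib]
    exact Finset.sum_congr rfl fun i _ => by simp only [hldef]; ring
  set u : (Fin N → ℝ) × (Fin k → ℝ) → ℝ := fun p => θ * hamiltonian c p.1 +
    quad (fun i => (1 - l i) / 2) p.2 with hu
  have hum : Measurable u := by fun_prop
  have hprod : (gibbs c θ).prod (gaussianPi l) =
      ((stdNormal N).prod (stdNormal k)).tilted u := by
    rw [hq, gibbs, prod_tilted (by fun_prop) (by fun_prop)]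
  have hui : Integrable (fun p => Real.exp (u p)) ((stdNormal N).prod (stdNormal k)) := by
    simp only [hu, Real.exp_add]
    exact (integrable_exp_of_bounded (by fun_prop) (mul_hamiltonian_le hb hc θ)).mul_prod hwi
  have hmain := abs_integral_tilted_sub_comp_le (measurePreserving_swapMap hd)
    (swapMap_involutive hd) hum hui (f := fun p => f fun i => p.1 (d i)) (by fun_prop)
    fun p => hB _
  rw [← hprod] at hmain
  set J := (gibbs c θ).prod (gaussianPi l) with hJ
  have e1 : ∫ p, f (fun i => p.1 (d i)) ∂J = ∫ g, f (fun i => g (d i)) ∂(gibbs c θ) := by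
    rw [hJ, integral_fun_fst fun g : Fin N → ℝ => f fun i => g (d i)]; simp
  have e2 : ∫ p, f (fun i => (swapMap d p).1 (d i)) ∂J = ∫ x, f x ∂(gaussianPi l) := by
    have : ∀ p : (Fin N → ℝ) × (Fin k → ℝ), (fun i => (swapMap d p).1 (d i)) = p.2 := fun p => by
      funext i
      simp only [swapMap, swapFun_apply_index hd, Sum.elim_inr]
    simp only [this]
    rw [hJ, integral_fun_snd f]; simp
  rw [e1, e2] at hmain
  refine hmain.trans ?_
  have hB0 : 0 ≤ B := (abs_nonneg _).trans (hB 0)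
  rw [mul_assoc (2 * B)]
  refine mul_le_mul_of_nonneg_left ?_ (by positivity)
  set K := 2 + |θ| * (3 * b + 1) with hK
  have hK0 : 0 ≤ K := by positivity
  -- the integrable majorant
  set S : (Fin N → ℝ) × (Fin k → ℝ) → ℝ := fun p =>
    2 * (k * ∑ i, p.1 (d i) ^ 4) + 2 * (k * ∑ i, p.2 i ^ 4) with hS
  set F : (Fin N → ℝ) × (Fin k → ℝ) → ℝ := fun p => K * (t * (1 + S p) +
    (quad (fun _ => 1) p.1 - N) ^ 2 / (N : ℝ) ^ 2 / t + (rayleigh c p.1 - v) ^ 2 / t) with hF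
  have hpt : ∀ p, min 1 |u p - u (swapMap d p)| ≤ F p := by
    intro p
    have q1 := quad_swapMap hd (fun _ => 1) p
    have q2 := quad_swapMap hd c p
    have hh := rayleigh_mem_Icc hb hc p.1
    have hEe : quad c p.1 = rayleigh c p.1 * quad (fun _ => 1) p.1 := by
      by_cases hg : p.1 = 0
      · simp [hg, quad]
      · rw [rayleigh, div_mul_cancel₀ _ (quad_pos (fun _ => one_pos) hg).ne']
    have hquad0 : ∀ x : Fin k → ℝ, 0 ≤ quad (fun _ => 1) x := fun x =>
      Finset.sum_nonneg fun i _ => mul_nonneg one_pos.le (sq_nonneg _)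
    have hdiff : ∀ x : Fin k → ℝ,
        |rayleigh c p.1 * quad (fun _ => 1) x - quad (fun i => c (d i)) x| ≤
          b * quad (fun _ => 1) x := fun x => by
      simp only [quad, Finset.mul_sum, ← Finset.sum_sub_distrib]
      refine (Finset.abs_sum_le_sum_abs _ _).trans (Finset.sum_le_sum fun i _ => ?_)
      have : rayleigh c p.1 * (1 * x i ^ 2) - c (d i) * x i ^ 2 =
          (rayleigh c p.1 - c (d i)) * x i ^ 2 := by ring
      rw [this, abs_mul, abs_of_nonneg (sq_nonneg (x i)), one_mul]
      refine mul_le_mul_of_nonneg_right ?_ (sq_nonneg _)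
      exact abs_le.2 ⟨by linarith [hh.1, (hc (d i)).2], by linarith [hh.2, (hc (d i)).1]⟩
    have hest := min_one_abs_exchange_le (n := N) (R := quad (fun _ => 1) p.1)
      (R' := quad (fun _ => 1) (swapMap d p).1) (E := quad c p.1) (E' := quad c (swapMap d p).1)
      (h := rayleigh c p.1) (h' := rayleigh c (swapMap d p).1)
      (ξ := quad (fun _ => 1) fun i => p.1 (d i)) (ξ' := quad (fun _ => 1) p.2)
      (a := quad (fun i => c (d i)) fun i => p.1 (d i)) (a' := quad (fun i => c (d i)) p.2)
      (b := b) (v := v) (θ := θ) hNr ht hNt hb (hquad0 _) (hquad0 _) hEe rfl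
      (by linarith) (by linarith) (by
        have h1 := hdiff p.2
        have h2 := hdiff fun i => p.1 (d i)
        rw [abs_le] at h1 h2 ⊢
        constructor <;> linarith [h1.1, h1.2, h2.1, h2.2])
    have hue : u p - u (swapMap d p) =
        θ * (N * rayleigh c p.1 + (quad (fun i => c (d i)) p.2 - v * quad (fun _ => 1) p.2)) -
        θ * (N * rayleigh c (swapMap d p).1 + (quad (fun i => c (d i)) (fun i => p.1 (d i)) -
          v * quad (fun _ => 1) fun i => p.1 (d i))) := by
      simp only [hu, hwe, hamiltonian_eq]
      have : (swapMap d p).2 = fun i => p.1 (d i) := rfl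
      rw [this]
      ring
    rw [hue]
    refine hest.trans (mul_le_mul_of_nonneg_left ?_ hK0)
    gcongr
    have s1 := sq_quad_one_le fun i => p.1 (d i)
    have s2 := sq_quad_one_le p.2
    refine add_sq_le.trans ?_
    simp only [hS]
    linarith
  have i1 : ∀ i, Integrable (fun g : Fin N → ℝ => g i ^ 4) (gibbs c θ) := fun i =>
    integrable_gibbs hb hc θ (by
      rw [stdNormal_eq_gaussianPi]; exact integrable_pow_four_gaussianPi _ i)
  have i2 : Integrable (fun g : Fin N → ℝ => (quad (fun _ => 1) g - N) ^ 2) (gibbs c θ) :=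
    integrable_gibbs hb hc θ (by
      rw [stdNormal_eq_gaussianPi]; exact integrable_sq_quad_sub _ _)
  have i3 : Integrable (fun g : Fin N → ℝ => (rayleigh c g - v) ^ 2) (gibbs c θ) := by
    refine Integrable.of_bound (by fun_prop) ((b + |v|) ^ 2) (ae_of_all _ fun g => ?_)
    rw [Real.norm_eq_abs, abs_of_nonneg (sq_nonneg _)]
    have h1 := rayleigh_mem_Icc hb hc g
    have h2 := neg_abs_le v
    have h3 := le_abs_self v
    exact sq_le_sq' (by linarith [h1.1]) (by linarith [h1.2])
  have j1 : Integrable (fun g : Fin N → ℝ => 2 * (k * ∑ i, g (d i) ^ 4)) (gibbs c θ) :=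
    ((integrable_finsetSum _ fun i _ => i1 (d i)).const_mul _).const_mul _
  have j2 : Integrable (fun x : Fin k → ℝ => 2 * (k * ∑ i, x i ^ 4)) (gaussianPi l) :=
    ((integrable_finsetSum _ fun i _ => integrable_pow_four_gaussianPi l i).const_mul _).const_mul _
  have hSi : Integrable S J := (j1.comp_fst _).add (j2.comp_snd _)
  have i2' := ((i2.div_const ((N : ℝ) ^ 2)).div_const t).comp_fst (gaussianPi l)
  have i3' := (i3.div_const t).comp_fst (gaussianPi l)
  have hX : Integrable (fun p => t * (1 + S p)) J := ((integrable_const 1).add hSi).const_mul t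
  have hXY : Integrable (fun p => t * (1 + S p) +
      (quad (fun _ => 1) p.1 - N) ^ 2 / (N : ℝ) ^ 2 / t) J := hX.add i2'
  have hFi : Integrable F J := (hXY.add i3').const_mul K
  have hSle : ∫ p, S p ∂J ≤ 4 * k ^ 2 * C := by
    have a1 : ∫ g, 2 * (k * ∑ i, g (d i) ^ 4) ∂(gibbs c θ) ≤ 2 * (k * (k * C)) := by
      rw [integral_const_mul, integral_const_mul, integral_finsetSum _ fun i _ => i1 (d i)]
      gcongr
      refine (Finset.sum_le_sum fun i _ => hC (d i)).trans_eq ?_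
      simp
    have a2 : ∫ x, 2 * (k * ∑ i, x i ^ 4) ∂(gaussianPi l) ≤ 2 * (k * (k * C)) := by
      rw [integral_const_mul, integral_const_mul,
        integral_finsetSum _ fun i _ => integrable_pow_four_gaussianPi l i]
      gcongr
      simp only [integral_pow_four_gaussianPi (l := l) hl]
      refine (Finset.sum_le_sum fun i _ => hC' i).trans_eq ?_
      simp
    have e : ∫ p, S p ∂J = ∫ g, 2 * (k * ∑ i, g (d i) ^ 4) ∂(gibbs c θ) +
        ∫ x, 2 * (k * ∑ i, x i ^ 4) ∂(gaussianPi l) := by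
      simp only [hS]
      rw [integral_add (j1.comp_fst _) (j2.comp_snd _),
        integral_fun_fst fun g : Fin N → ℝ => 2 * (k * ∑ i, g (d i) ^ 4),
        integral_fun_snd fun x : Fin k → ℝ => 2 * (k * ∑ i, x i ^ 4)]
      simp
    rw [e]
    linarith
  have hYle : ∫ p, (quad (fun _ => 1) p.1 - N) ^ 2 / (N : ℝ) ^ 2 / t ∂J ≤ D * t := by
    rw [hJ, integral_fun_fst fun g : Fin N → ℝ => (quad (fun _ => 1) g - N) ^ 2 / (N : ℝ) ^ 2 / t,
      integral_div, integral_div]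
    simp only [probReal_univ, one_smul]
    have hD0 : 0 ≤ D * N := (integral_nonneg fun g => sq_nonneg _).trans hD
    have hD1 : 0 ≤ D := nonneg_of_mul_nonneg_left hD0 (by linarith)
    rw [div_div, div_le_iff₀ (by positivity)]
    refine hD.trans ?_
    have h1 : 1 ≤ t ^ 2 * N := by
      rwa [div_le_iff₀ (by linarith)] at hNt
    have h2 := mul_le_mul_of_nonneg_left h1 hD0
    linarith
  have hVle : ∫ p, (rayleigh c p.1 - v) ^ 2 / t ∂J ≤ t := by
    rw [hJ, integral_fun_fst fun g : Fin N → ℝ => (rayleigh c g - v) ^ 2 / t, integral_div]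
    simp only [probReal_univ, one_smul]
    rw [div_le_iff₀ ht]
    linarith
  calc ∫ p, min 1 |u p - u (swapMap d p)| ∂J ≤ ∫ p, F p ∂J :=
        integral_mono_of_nonneg (ae_of_all _ fun p => le_min zero_le_one (abs_nonneg _)) hFi
          (ae_of_all _ hpt)
    _ = K * (t * (1 + ∫ p, S p ∂J) + ∫ p, (quad (fun _ => 1) p.1 - N) ^ 2 / (N : ℝ) ^ 2 / t ∂J +
          ∫ p, (rayleigh c p.1 - v) ^ 2 / t ∂J) := by
        simp only [hF]
        rw [integral_const_mul, integral_add hXY i3', integral_add hX i2',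
          integral_const_mul, integral_add (integrable_const 1) hSi]
        simp
    _ ≤ K * (t * (1 + 4 * k ^ 2 * C) + D * t + t) := by gcongr
    _ = _ := by ring

/-! ### Moment bounds for the Gibbs measure -/

section Saddle

variable {N : ℕ} {c : Fin N → ℝ} {θ κ : ℝ}

theorem rayleigh_affine {g : Fin N → ℝ} (hg : g ≠ 0) :
    rayleigh (fun i => 2 * θ * (κ - c i)) g = 2 * θ * (κ - rayleigh c g) := by
  have h := (quad_pos (fun _ => one_pos) hg).ne'
  have e : quad (fun i => 2 * θ * (κ - c i)) g =
      2 * θ * (κ * quad (fun _ => 1) g - quad c g) := by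
    simp only [quad, Finset.mul_sum, ← Finset.sum_sub_distrib]
    exact Finset.sum_congr rfl fun i _ => by ring
  rw [rayleigh, rayleigh, e]
  field_simp

/-- On the unit sphere a shift of all `γ_i` by `κ` only adds a constant to the exponent. Thus `κ` is
free here; the saddle point condition enters only through the estimates. -/
theorem gibbs_eq_rayleighGibbs (hN : N ≠ 0) :
    gibbs c θ = rayleighGibbs fun i => 2 * θ * (κ - c i) := by
  rw [gibbs, rayleighGibbs, ← tilted_add_const _ (fun g : Fin N → ℝ =>
    (N : ℝ) * (1 - rayleigh (fun i => 2 * θ * (κ - c i)) g) / 2) (N * θ * κ - N / 2)]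
  refine tilted_congr ?_
  filter_upwards [ae_ne_zero_stdNormal hN] with g hg
  rw [hamiltonian_eq, rayleigh_affine hg]
  ring

theorem sum_one_div_eq (hN : N ≠ 0) (hθ : θ ≠ 0)
    (hκ : (N : ℝ)⁻¹ * ∑ i, 1 / (κ - c i) = 2 * θ) : ∑ i, 1 / (2 * θ * (κ - c i)) = N := by
  have hNr : (N : ℝ) ≠ 0 := by exact_mod_cast hN
  have h : ∑ i, 1 / (κ - c i) = N * (2 * θ) := by
    rw [← hκ, mul_inv_cancel_left₀ hNr]
  simp only [one_div, mul_inv] at h ⊢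
  rw [← Finset.mul_sum, h]
  field_simp

theorem integral_sq_rayleigh_sub_gibbs_le (hN : N ≠ 0) (hθ : θ ≠ 0) {m M K : ℝ} (hm : 0 < m)
    (hml : ∀ i, m ≤ 2 * θ * (κ - c i)) (hlM : ∀ i, 2 * θ * (κ - c i) ≤ M)
    (hκ : (N : ℝ)⁻¹ * ∑ i, 1 / (κ - c i) = 2 * θ) :
    ∫ g, (rayleigh c g - (K - 1 / (2 * θ))) ^ 2 ∂(gibbs c θ) ≤
      1 / (2 * θ ^ 2) * (dominationConst m M * (normalFourthMoment * (1 + 1 / m) ^ 2) / N) +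
        2 * (κ - K) ^ 2 := by
  set l : Fin N → ℝ := fun i => 2 * θ * (κ - c i) with hl
  have hpos : ∀ i, 0 < l i := fun i => hm.trans_le (hml i)
  have hP := isProbabilityMeasure_rayleighGibbs hpos
  have hle := integral_sq_rayleigh_sub_one_le hN hm hml hlM (sum_one_div_eq hN hθ hκ)
  have hM : 0 < M := (hpos ⟨0, Nat.pos_of_ne_zero hN⟩).trans_le (hlM _)
  have hi : Integrable (fun g => (rayleigh l g - 1) ^ 2) (rayleighGibbs l) := by
    refine Integrable.of_bound (by fun_prop) ((M + 1) ^ 2) (ae_of_all _ fun g => ?_)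
    rw [Real.norm_eq_abs, abs_of_nonneg (sq_nonneg _)]
    have h0 := rayleigh_nonneg hpos g
    have hle : rayleigh l g ≤ M := by
      by_cases hg : g = 0
      · rw [hg, rayleigh_zero]; exact hM.le
      · exact (rayleigh_mem hml hlM hg).2
    exact sq_le_sq' (by linarith) (by linarith)
  rw [gibbs_eq_rayleighGibbs (κ := κ) hN]
  have hne : ∀ᵐ g ∂(rayleighGibbs l), g ≠ 0 :=
    (tilted_absolutelyContinuous _ _).ae_le (ae_ne_zero_stdNormal hN)
  calc ∫ g, (rayleigh c g - (K - 1 / (2 * θ))) ^ 2 ∂(rayleighGibbs l)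
      ≤ ∫ g, (1 / (2 * θ ^ 2) * (rayleigh l g - 1) ^ 2 + 2 * (κ - K) ^ 2)
          ∂(rayleighGibbs l) := by
        refine integral_mono_of_nonneg (ae_of_all _ fun g => sq_nonneg _)
          ((hi.const_mul _).add (integrable_const _)) ?_
        filter_upwards [hne] with g hg
        rw [hl, rayleigh_affine hg]
        -- The first part is the fluctuation around the empirical saddle point `κ`, the second the
        -- bias from using `K` in its place.
        have e : rayleigh c g - (K - 1 / (2 * θ)) =
            -(2 * θ * (κ - rayleigh c g) - 1) / (2 * θ) + (κ - K) := by
          field_simp; ring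
        rw [e]
        refine add_sq_le.trans_eq ?_
        rw [div_pow]
        field_simp
    _ = 1 / (2 * θ ^ 2) * ∫ g, (rayleigh l g - 1) ^ 2 ∂(rayleighGibbs l) +
          2 * (κ - K) ^ 2 := by
        rw [integral_add (hi.const_mul _) (integrable_const _), integral_const_mul]
        simp
    _ ≤ _ := by gcongr

end Saddle

/-! ### Convergence of product Gaussians -/

/-- Scaling moves the variances from the measure into the integrand, so convergence of variances can
be handled by dominated convergence on a fixed space. -/
theorem integral_gaussianPi_eq_stdNormal {k : ℕ} (l : Fin k → ℝ) {f : (Fin k → ℝ) → ℝ}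
    (hf : Measurable f) :
    ∫ x, f x ∂(gaussianPi l) =
      ∫ x, f (fun i => √(Real.toNNReal (1 / l i) : ℝ) * x i) ∂(stdNormal k) := by
  have e : gaussianPi l = (stdNormal k).map fun x i => √(Real.toNNReal (1 / l i) : ℝ) * x i := by
    rw [stdNormal, Measure.pi_map_pi
      (f := fun i x => √(Real.toNNReal (1 / l i) : ℝ) * x) fun i => by fun_prop]
    simp only [gaussianPi, ← gaussianReal_eq_map]
  rw [e, integral_map (Measurable.aemeasurable (by fun_prop)) hf.aestronglyMeasurable]

theorem tendsto_integral_gaussianPi {k : ℕ} {l : ℕ → Fin k → ℝ} {l₀ : Fin k → ℝ}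
    (hl₀ : ∀ i, l₀ i ≠ 0) (hl : ∀ i, Tendsto (fun n => l n i) atTop (𝓝 (l₀ i)))
    (f : (Fin k → ℝ) →ᵇ ℝ) :
    Tendsto (fun n => ∫ x, f x ∂(gaussianPi (l n))) atTop (𝓝 (∫ x, f x ∂(gaussianPi l₀))) := by
  simp only [integral_gaussianPi_eq_stdNormal _ f.continuous.measurable]
  refine tendsto_integral_of_dominated_convergence (fun _ => ‖f‖) (fun n => ?_)
    (integrable_const _) (fun n => ae_of_all _ fun x => f.norm_coe_le_norm _)
    (ae_of_all _ fun x => ?_)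
  · exact (f.continuous.measurable.comp (by fun_prop)).aestronglyMeasurable
  · refine (f.continuous.tendsto _).comp (tendsto_pi_nhds.2 fun i => ?_)
    refine Tendsto.mul_const _ ?_
    refine (Real.continuous_sqrt.tendsto _).comp ?_
    refine (NNReal.continuous_coe.tendsto _).comp ?_
    exact (continuous_real_toNNReal.tendsto _).comp (tendsto_const_nhds.div (hl i) (hl₀ i))

/-! ### The limiting energy -/

theorem energyError_eq {ρ : Measure ℝ} {b θ : ℝ} {N : ℕ} (hN : N ≠ 0) (c : Fin N → ℝ) :
    energyError ρ b θ c = ∫ g, (rayleigh c g - limitEnergy ρ b θ) ^ 2 ∂(gibbs c θ) := by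
  simp only [energyError, gibbsMean_eq, energy_eq hN]

theorem one_div_sqrt_le_rate {ρ : Measure ℝ} {b θ : ℝ} {N : ℕ} (c : Fin N → ℝ) :
    1 / √(N : ℝ) ≤ rate ρ b θ c :=
  le_add_of_nonneg_right (Real.sqrt_nonneg _)

theorem pi_marginalLaw_eq {ρ : Measure ℝ} {b θ : ℝ} {k : ℕ} (x : Fin k → ℝ) :
    Measure.pi (fun i => marginalLaw ρ b θ (x i)) =
      gaussianPi fun i => 1 + 2 * θ * (limitEnergy ρ b θ - x i) := rfl

section Limit

variable {b : ℝ} {γ : (N : ℕ) → Fin N → ℝ} {ρ : Measure ℝ} [IsProbabilityMeasure ρ] {θ : ℝ}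

/-- The saddle point `K = K_ρ(2θ)` lies off `[0, b]`, on the side given by the sign of `θ`. -/
theorem exists_limitEnergy_eq (hb : 0 < b) (hae : ∀ᵐ x ∂ρ, x ∈ Icc 0 b)
    (hθ : θ ∈ highTemp ρ b) : ∃ K δ, 0 < δ ∧ stieltjes ρ b K = 2 * θ ∧
      limitEnergy ρ b θ = K - 1 / (2 * θ) ∧
      ((K + 2 * δ < 0 ∧ θ < 0) ∨ (b < K - 2 * δ ∧ 0 < θ)) := by
  have hex := exists_stieltjes_eq hb hae hθ
  have hmem : stieltjesInv ρ b (2 * θ) ∈ (Icc 0 b)ᶜ := Function.invFunOn_mem hex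
  have heq : stieltjes ρ b (stieltjesInv ρ b (2 * θ)) = 2 * θ := Function.invFunOn_eq hex
  rcases lt_zero_or_lt_of_stieltjes_eq hae hmem heq hb with ⟨h1, h2⟩ | ⟨h1, h2⟩
  -- A quarter of the distance from the saddle point to `[0, b]`: any `κ` within `δ` of it stays at
  -- distance at least `δ` from the interval.
  · exact ⟨_, -stieltjesInv ρ b (2 * θ) / 4, by linarith, heq, rfl, Or.inl ⟨by linarith, h2⟩⟩
  · exact ⟨_, (stieltjesInv ρ b (2 * θ) - b) / 4, by linarith, heq, rfl,
      Or.inr ⟨by linarith, h2⟩⟩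

theorem mul_sub_mem_of_abs_sub_le {K δ κ x : ℝ} (hb : 0 < b)
    (hside : (K + 2 * δ < 0 ∧ θ < 0) ∨ (b < K - 2 * δ ∧ 0 < θ))
    (hκ : |κ - K| ≤ δ) (hx : x ∈ Icc 0 b) :
    2 * θ * (κ - x) ∈ Icc (2 * |θ| * δ) (2 * |θ| * (|K| + δ + b)) := by
  have h1 := abs_le.1 hκ
  have hK := abs_le.1 (le_refl |K|)
  rcases hside with ⟨hs, ht⟩ | ⟨hs, ht⟩
  · rw [abs_of_neg ht]
    constructor <;> nlinarith [hx.1, hx.2, h1.1, h1.2, hK.1, hK.2]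
  · rw [abs_of_pos ht]
    constructor <;> nlinarith [hx.1, hx.2, h1.1, h1.2, hK.1, hK.2]

/-- Moment bounds for the Gibbs measure that are uniform in large `N`. -/
theorem exists_gibbs_moment_bounds (hb : 0 < b) (hγ : ∀ N i, γ N i ∈ Icc 0 b)
    (hρ : Tendsto (fun N => wasserstein1 (empiricalMeasure (γ N)) ρ) atTop (𝓝 0))
    (hθ : θ ∈ highTemp ρ b) :
    ∃ m C C₁ : ℝ, 0 < m ∧ 0 ≤ C ∧ 0 ≤ C₁ ∧
      (∀ x ∈ Icc 0 b, m ≤ 1 + 2 * θ * (limitEnergy ρ b θ - x)) ∧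
      ∀ ε > 0, ∀ᶠ N in atTop, (∀ i, ∫ g, g i ^ 4 ∂(gibbs (γ N) θ) ≤ C) ∧
        ∫ g, (quad (fun _ => 1) g - N) ^ 2 ∂(gibbs (γ N) θ) ≤ normalFourthMoment * N ∧
        ∫ g, (rayleigh (γ N) g - limitEnergy ρ b θ) ^ 2 ∂(gibbs (γ N) θ) ≤
          C₁ / N + 2 * ε ^ 2 := by
  have hae := ae_mem_Icc_of_wasserstein1 hb hγ hρ
  obtain ⟨K, δ, hδ, hK, hv, hside⟩ := exists_limitEnergy_eq hb hae hθ
  have hθ0 : θ ≠ 0 := hθ.2.2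
  have hθa : 0 < |θ| := abs_pos.2 hθ0
  set m := 2 * |θ| * δ with hm
  set M := 2 * |θ| * (|K| + δ + b) with hM
  have hm0 : 0 < m := by positivity
  have hn := normalFourthMoment_nonneg
  have hdom := dominationConst_nonneg (m := m) (M := M)
  refine ⟨m, dominationConst m M * (normalFourthMoment / m ^ 2) * (normalFourthMoment + 1),
    1 / (2 * θ ^ 2) * (dominationConst m M * (normalFourthMoment * (1 + 1 / m) ^ 2)),
    hm0, by positivity, by positivity, fun x hx => ?_, fun ε hε => ?_⟩
  · have h := (mul_sub_mem_of_abs_sub_le hb hside (by simpa using hδ.le : |K - K| ≤ δ) hx).1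
    -- The inverse variances of the limit law are the precisions at the saddle point itself, which
    -- explains their positivity.
    have e : 1 + 2 * θ * (limitEnergy ρ b θ - x) = 2 * θ * (K - x) := by
      rw [hv]; field_simp; ring
    rw [e]
    exact h
  -- `δ` keeps the precisions in the fixed interval `[m, M]`, so the constants do not depend on `ε`,
  -- while `ε` bounds the bias `κ - K`. Only the threshold for `N` depends on `ε`.
  · have hεδ : 0 < min ε δ := lt_min hε hδ
    have hz : K + min ε δ < 0 ∨ b < K - min ε δ := by
      have := min_le_right ε δ
      exact hside.imp (fun h => by linarith [h.1]) (fun h => by linarith [h.1])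
    filter_upwards [eventually_exists_sum_one_div_eq hb hγ hρ hεδ hz hK,
      eventually_ne_atTop 0] with N hκ hN
    obtain ⟨κ, hκK, hκ⟩ := hκ
    have hmem : ∀ i, 2 * θ * (κ - γ N i) ∈ Icc m M := fun i =>
      mul_sub_mem_of_abs_sub_le hb hside (hκK.trans (min_le_right _ _)) (hγ N i)
    refine ⟨fun i => ?_, ?_, ?_⟩
    · rw [gibbs_eq_rayleighGibbs (κ := κ) hN]
      exact integral_pow_four_rayleighGibbs_le hN hm0 (fun i => (hmem i).1) (fun i => (hmem i).2)
        (sum_one_div_eq hN hθ0 hκ) i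
    · rw [gibbs_eq_rayleighGibbs (κ := κ) hN]
      exact integral_sq_quad_one_sub_rayleighGibbs_le hN fun i => hm0.trans_le (hmem i).1
    · rw [hv]
      refine (integral_sq_rayleigh_sub_gibbs_le hN hθ0 (K := K) hm0 (fun i => (hmem i).1)
        (fun i => (hmem i).2) hκ).trans ?_
      rw [← mul_div_assoc]
      have h1 : |κ - K| ≤ ε := hκK.trans (min_le_left _ _)
      have h2 : (κ - K) ^ 2 ≤ ε ^ 2 := by
        rw [← sq_abs (κ - K)]; exact pow_le_pow_left₀ (abs_nonneg _) h1 2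
      linarith

theorem tendsto_rate (hb : 0 < b) (hγ : ∀ N i, γ N i ∈ Icc 0 b)
    (hρ : Tendsto (fun N => wasserstein1 (empiricalMeasure (γ N)) ρ) atTop (𝓝 0))
    (hθ : θ ∈ highTemp ρ b) : Tendsto (fun N => rate ρ b θ (γ N)) atTop (𝓝 0) := by
  obtain ⟨m, C, C₁, -, -, -, -, hbd⟩ := exists_gibbs_moment_bounds hb hγ hρ hθ
  have ha : Tendsto (fun N => energyError ρ b θ (γ N)) atTop (𝓝 0) := by
    refine tendsto_order.2 ⟨fun η hη => ?_, fun η hη => ?_⟩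
    · filter_upwards [eventually_ne_atTop 0] with N hN
      rw [energyError_eq hN]
      exact hη.trans_le (integral_nonneg fun g => sq_nonneg _)
    · have hC : Tendsto (fun N : ℕ => C₁ / (N : ℝ)) atTop (𝓝 0) :=
        tendsto_const_div_atTop_nhds_zero_nat C₁
      -- With this `ε` the bias term `2 ε ^ 2` is `η / 2`, and `C₁ / N` takes the other half.
      filter_upwards [hbd (√(η / 4)) (Real.sqrt_pos.2 (by linarith)), eventually_ne_atTop 0,
        hC.eventually_lt_const (half_pos hη)] with N hN hN0 hN1
      rw [energyError_eq hN0]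
      have h := hN.2.2
      rw [Real.sq_sqrt (by linarith)] at h
      linarith
  have h1 : Tendsto (fun N : ℕ => 1 / √(N : ℝ)) atTop (𝓝 0) := by
    simp only [one_div]
    exact tendsto_inv_atTop_zero.comp
      (Real.tendsto_sqrt_atTop.comp tendsto_natCast_atTop_atTop)
  have h2 := h1.add ((Real.continuous_sqrt.tendsto 0).comp ha)
  simpa [rate, Function.comp_def] using h2

theorem exists_abs_gibbsMean_sub_le (hb : 0 < b) (hγ : ∀ N i, γ N i ∈ Icc 0 b)
    (hρ : Tendsto (fun N => wasserstein1 (empiricalMeasure (γ N)) ρ) atTop (𝓝 0))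
    (hθ : θ ∈ highTemp ρ b) {k : ℕ} (hk : 1 ≤ k) :
    ∃ K : ℝ, 0 < K ∧ ∀ (N : ℕ) (d : Fin k → Fin N), Function.Injective d →
      ∀ f : (Fin k → ℝ) → ℝ, Measurable f → (∃ C, ∀ x, |f x| ≤ C) →
        |gibbsMean (γ N) θ (fun g => f fun i => g (d i)) -
            ∫ x, f x ∂(Measure.pi fun i => marginalLaw ρ b θ (γ N (d i)))|
          ≤ K * (⨆ x, |f x|) * rate ρ b θ (γ N) := by
  obtain ⟨m, C, C₁, hm, hC, -, hml, hbd⟩ := exists_gibbs_moment_bounds hb hγ hρ hθ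
  -- Any `ε` serves: only the length and fourth moment bounds are used, since the energy error is
  -- itself part of the rate.
  obtain ⟨N₀, hN₀⟩ := eventually_atTop.1 (hbd 1 one_pos)
  have hn := normalFourthMoment_nonneg
  set C' := C + normalFourthMoment / m ^ 2 with hC'
  have hC'0 : 0 ≤ C' := by positivity
  set K₁ := 2 * ((2 + |θ| * (3 * b + 1)) * (2 + 4 * (k : ℝ) ^ 2 * C' + normalFourthMoment)) with hK₁
  have hK₁0 : 0 < K₁ := by positivity
  -- The term `2 * √N₀` covers `N < N₀`, where the trivial bound `2 ‖f‖` suffices because the rate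
  -- is at least `1 / √N`.
  refine ⟨K₁ + 2 * √N₀, by positivity, fun N d hd f hf hbdd => ?_⟩
  have hN : N ≠ 0 := by
    rintro rfl
    exact (d ⟨0, hk⟩).elim0
  have hNr : (0 : ℝ) < N := by exact_mod_cast Nat.pos_of_ne_zero hN
  set t := rate ρ b θ (γ N) with ht
  set B := ⨆ x, |f x| with hBdef
  have hB : ∀ x, |f x| ≤ B := by
    obtain ⟨D, hD⟩ := hbdd
    exact fun x => le_ciSup (f := fun x => |f x|) ⟨D, by rintro _ ⟨y, rfl⟩; exact hD y⟩ x
  have hB0 : 0 ≤ B := (abs_nonneg _).trans (hB 0)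
  have hsqrt : 0 < √(N : ℝ) := Real.sqrt_pos.2 hNr
  have ht1 : 1 / √(N : ℝ) ≤ t := one_div_sqrt_le_rate _
  have ht0 : 0 < t := lt_of_lt_of_le (by positivity) ht1
  rw [gibbsMean_eq, pi_marginalLaw_eq]
  have hP := isProbabilityMeasure_gibbs hb.le (hγ N) θ
  rcases lt_or_ge N N₀ with hlt | hge
  · have h1 : |∫ g, f (fun i => g (d i)) ∂(gibbs (γ N) θ)| ≤ B := by
      refine (norm_integral_le_of_norm_le_const (f := fun g : Fin N → ℝ => f fun i => g (d i))
        (C := B) (ae_of_all _ fun g => hB _)).trans_eq ?_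
      simp
    have h2 : |∫ x, f x ∂(gaussianPi fun i => 1 + 2 * θ * (limitEnergy ρ b θ - γ N (d i)))| ≤
        B := by
      refine (norm_integral_le_of_norm_le_const (f := f)
        (C := B) (ae_of_all _ fun x => hB x)).trans_eq ?_
      simp
    have h3 : 1 ≤ √N₀ * t := by
      have : √(N : ℝ) ≤ √N₀ := Real.sqrt_le_sqrt (by exact_mod_cast hlt.le)
      calc (1 : ℝ) = √(N : ℝ) * (1 / √(N : ℝ)) := by field_simp
        _ ≤ √N₀ * t := by gcongr
    calc _ ≤ B + B := (abs_sub _ _).trans (add_le_add h1 h2)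
      _ = 2 * B * 1 := by ring
      _ ≤ 2 * B * (√N₀ * t) := by gcongr
      _ ≤ K₁ * B * t + 2 * B * (√N₀ * t) := le_add_of_nonneg_left (by positivity)
      _ = _ := by ring
  · obtain ⟨b1, b2, -⟩ := hN₀ N hge
    have hNt : 1 / (N : ℝ) ≤ t ^ 2 := by
      have := pow_le_pow_left₀ (by positivity) ht1 2
      rwa [div_pow, one_pow, Real.sq_sqrt hNr.le] at this
    have hv : ∫ g, (rayleigh (γ N) g - limitEnergy ρ b θ) ^ 2 ∂(gibbs (γ N) θ) ≤ t ^ 2 := by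
      rw [← energyError_eq hN]
      have ha : 0 ≤ energyError ρ b θ (γ N) := by
        rw [energyError_eq hN]; exact integral_nonneg fun g => sq_nonneg _
      calc energyError ρ b θ (γ N) = √(energyError ρ b θ (γ N)) ^ 2 := (Real.sq_sqrt ha).symm
        _ ≤ t ^ 2 := pow_le_pow_left₀ (Real.sqrt_nonneg _)
            (le_add_of_nonneg_left (by positivity)) 2
    have h := abs_integral_gibbs_sub_le hN hb.le (hγ N) ht0 hNt hd
      (fun i => hm.trans_le (hml _ (hγ N (d i)))) (C := C')
      (fun i => (b1 i).trans (le_add_of_nonneg_right (by positivity)))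
      (fun i => by
        refine le_trans ?_ (le_add_of_nonneg_left hC)
        exact div_le_div_of_nonneg_left hn (by positivity)
          (pow_le_pow_left₀ hm.le (hml _ (hγ N (d i))) 2)) b2 hv hf hB
    refine h.trans ?_
    calc _ = K₁ * B * t := by rw [hK₁]; ring
      _ ≤ K₁ * B * t + 2 * √N₀ * B * t := le_add_of_nonneg_right (by positivity)
      _ = _ := by ring

end Limit

end SphericalModel

theorem corollary1
    -- the eigenvalues `γ N i`, `i < N`, lie in `[0, b]`, and their empirical measures converge to `ρ`
    (b : ℝ) (hb : 0 < b)
    (γ : (N : ℕ) → Fin N → ℝ) (hγ : ∀ N i, γ N i ∈ Icc 0 b)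
    (ρ : Measure ℝ) [IsProbabilityMeasure ρ]
    (hρ : Tendsto (fun N => SphericalModel.wasserstein1
      (SphericalModel.empiricalMeasure (γ N)) ρ) atTop (𝓝 0))
    (θ : ℝ) (hθ : θ ∈ SphericalModel.highTemp ρ b)
    (k : ℕ) (hk : 1 ≤ k) :
    -- the Gaussian variances are well defined and positive
    (∀ x ∈ Icc 0 b, 0 < 1 + 2 * θ * (SphericalModel.limitEnergy ρ b θ - x)) ∧
    -- the quantitative bound
    (∃ K : ℝ, 0 < K ∧ ∀ (N : ℕ) (d : Fin k → Fin N), Function.Injective d →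
      ∀ f : (Fin k → ℝ) → ℝ, Measurable f → (∃ C, ∀ x, |f x| ≤ C) →
        |SphericalModel.gibbsMean (γ N) θ (fun g => f fun i => g (d i)) -
            ∫ x, f x ∂(Measure.pi fun i => SphericalModel.marginalLaw ρ b θ (γ N (d i)))|
          ≤ K * (⨆ x, |f x|) * SphericalModel.rate ρ b θ (γ N)) ∧
    -- the rate vanishes
    Tendsto (fun N => SphericalModel.rate ρ b θ (γ N)) atTop (𝓝 0) ∧
    -- weak convergence of the finite marginals, along any sizes `n m → ∞` and distinct indices
    (∀ (n : ℕ → ℕ), Tendsto n atTop atTop →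
      ∀ d : (m : ℕ) → Fin k → Fin (n m), (∀ m, Function.Injective (d m)) →
        (∀ f : (Fin k → ℝ) →ᵇ ℝ,
          Tendsto (fun m =>
            SphericalModel.gibbsMean (γ (n m)) θ (fun g => f fun i => g (d m i)) -
              ∫ x, f x ∂(Measure.pi fun i =>
                SphericalModel.marginalLaw ρ b θ (γ (n m) (d m i)))) atTop (𝓝 0)) ∧
        (∀ c : Fin k → ℝ, (∀ i, Tendsto (fun m => γ (n m) (d m i)) atTop (𝓝 (c i))) →
          ∀ f : (Fin k → ℝ) →ᵇ ℝ,
            Tendsto (fun m =>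
              SphericalModel.gibbsMean (γ (n m)) θ (fun g => f fun i => g (d m i))) atTop
              (𝓝 (∫ x, f x ∂(Measure.pi fun i => SphericalModel.marginalLaw ρ b θ (c i)))))) := by
  obtain ⟨m, -, -, hm, -, -, hml, -⟩ := SphericalModel.exists_gibbs_moment_bounds hb hγ hρ hθ
  have hpos : ∀ x ∈ Icc 0 b, 0 < 1 + 2 * θ * (SphericalModel.limitEnergy ρ b θ - x) :=
    fun x hx => hm.trans_le (hml x hx)
  obtain ⟨K, hK, hbound⟩ := SphericalModel.exists_abs_gibbsMean_sub_le hb hγ hρ hθ hk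
  have hrate := SphericalModel.tendsto_rate hb hγ hρ hθ
  refine ⟨hpos, ⟨K, hK, hbound⟩, hrate, fun n hn d hd => ?_⟩
  have hdiff : ∀ f : (Fin k → ℝ) →ᵇ ℝ, Tendsto (fun m =>
      SphericalModel.gibbsMean (γ (n m)) θ (fun g => f fun i => g (d m i)) -
        ∫ x, f x ∂(Measure.pi fun i =>
          SphericalModel.marginalLaw ρ b θ (γ (n m) (d m i)))) atTop (𝓝 0) := by
    intro f
    refine squeeze_zero_norm (fun m => hbound (n m) (d m) (hd m) f f.continuous.measurable
      ⟨‖f‖, fun x => f.norm_coe_le_norm x⟩) ?_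
    simpa using (hrate.comp hn).const_mul (K * ⨆ x, |f x|)
  refine ⟨hdiff, fun c hc f => ?_⟩
  -- Closedness of `[0, b]` keeps the limiting inverse variances positive, so the variances depend
  -- continuously on the parameters there.
  have hcmem : ∀ i, c i ∈ Icc 0 b := fun i =>
    isClosed_Icc.mem_of_tendsto (hc i) (Eventually.of_forall fun m => hγ _ _)
  have hlim := SphericalModel.tendsto_integral_gaussianPi
    (l := fun m i => 1 + 2 * θ * (SphericalModel.limitEnergy ρ b θ - γ (n m) (d m i)))
    (l₀ := fun i => 1 + 2 * θ * (SphericalModel.limitEnergy ρ b θ - c i))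
    (fun i => (hpos _ (hcmem i)).ne')
    (fun i => tendsto_const_nhds.add ((tendsto_const_nhds.sub (hc i)).const_mul _)) f
  have h := (hdiff f).add hlim
  rw [zero_add] at h
  exact h.congr fun m => sub_add_cancel _ _
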